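/- Let $(N,g)$ be a smooth (Hausdorff) Riemannian manifold of dimension $n$, without boundary. For $x\in N$ let $\exp_x$ be the geodesic exponential map at $x$, defined on the open set of those $v\in T_xN$ for which the geodesic $\gamma$ with $\gamma(0)=x$, $\dot\gamma(0)=v$ exists on $[0,1]$, with $\exp_x(v)=\gamma(1)$. For $v$ in this domain, $x$ and $\exp_x(v)$ are called conjugate along $\gamma$ if $\ker \mathrm d(\exp_x)_v\neq 0$, and $\dim\ker \mathrm d(\exp_x)_v$ is then their multiplicity; the conjugate locus of $x$ is the set of all points $\exp_x(v)$ that are conjugate to $x$ in this way. (i) If $x$ and $\exp_x(v)$ are conjugate along the geodesic with initial velocity $v$, then their multiplicity is at most $n-1$. (ii) Let $\omega$ be the canonical symplectic form on $\pi\colon T^*N\to N$, let $\Phi$ be the time-1-map of the Hamiltonian flow of $H(\alpha)=\frac12\alpha(g^{-1}\alpha)$ (defined where the flow exists up to time 1), and let $\Gamma\subset T^*N\times T^*N$ be its graph. Let $X$ be a point in the conjugate locus of $x$, and let $\alpha\in T^*N$ solve the boundary value problem $\pi(\alpha)=x$, $\pi(\Phi(\alpha))=X$. Then the degeneracy of the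 singularity of this problem at $\alpha$ is at most $n-1$. Here the degeneracy is defined as follows. Put $\Pi=T_x^*N\times T_X^*N$ and $p=(\alpha,\Phi(\alpha))\in\Gamma\cap\Pi$. Take a symplectomorphism $\Psi$ from a neighbourhood $U$ of $p$ in $(T^*N\times T^*N,\omega\oplus(-\omega))$ onto an open subset of $T^*\mathbb R^{2n}$ that maps $\Gamma\cap U$ and $\Pi\cap U$ onto the images of exact 1-forms $\mathrm df$ and $\mathrm dh$ with smooth functions $f,h$ on an open set $D\subset\mathbb R^{2n}$. The degeneracy is the dimension of the kernel of the Hessian of $f-h$ at the base point of $\Psi(p)$. The bound holds for every choice of $\Psi,D,f,h$. -/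

import Mathlib

open Set Bundle Manifold Module
open scoped ContDiff Topology

noncomputable section

namespace ConjugatePoints

variable {E : Type*} [NormedAddCommGroup E] [NormedSpace ℝ E]
  {M : Type*} [TopologicalSpace M] [ChartedSpace E M]

/-! ### Geodesics, the exponential map, conjugate points -/

section Geodesics

variable [RiemannianBundle (fun x : M ↦ TangentSpace 𝓘(ℝ, E) x)]

/-- The Riemannian metric in the chart centred at `c`: the inner product of the tangent vectors at
the point with coordinates `u` whose coordinates are `v` and `w`. -/
def chartMetric (c : M) (u v w : E) : ℝ :=
  letI D : E →L[ℝ] TangentSpace 𝓘(ℝ, E) ((extChartAt 𝓘(ℝ, E) c).symm u) :=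
    mfderiv 𝓘(ℝ, E) 𝓘(ℝ, E) (extChartAt 𝓘(ℝ, E) c).symm u
  inner ℝ (D v) (D w)

/-- The Christoffel symbols of the first kind of the Levi-Civita connection in the chart centred at
`c`: `christoffel c u v w z` is `g(∇_V W, Z)` at the point with coordinates `u`, where `V`, `W`, `Z`
are the vector fields with constant coordinates `v`, `w`, `z`. -/
def christoffel (c : M) (u v w z : E) : ℝ :=
  (fderiv ℝ (fun u' ↦ chartMetric c u' w z) u v
    + fderiv ℝ (fun u' ↦ chartMetric c u' v z) u w
    - fderiv ℝ (fun u' ↦ chartMetric c u' v w) u z) / 2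

/-- A curve is a geodesic on the open set `J` of times if, at each `t ∈ J`, it is twice
differentiable and its covariant acceleration vanishes. With `q` the curve read in a chart at
`γ t`, the last condition says `g(q'' + Γ(q', q'), z) = 0` for all `z`. -/
def IsGeodesicOn (γ : ℝ → M) (J : Set ℝ) : Prop :=
  ∀ t ∈ J, ContinuousAt γ t ∧
    letI q : ℝ → E := fun s ↦ extChartAt 𝓘(ℝ, E) (γ t) (γ s)
    (∀ᶠ s in 𝓝 t, DifferentiableAt ℝ q s) ∧ DifferentiableAt ℝ (deriv q) t ∧
      ∀ z : E, chartMetric (γ t) (q t) (deriv (deriv q) t) z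
        + christoffel (γ t) (q t) (deriv q t) (deriv q t) z = 0

/-- `γ` is a geodesic, defined on an open interval around `[0, 1]`, that starts at `x` with
velocity `v`. -/
def IsGeodesicFrom (x : M) (v : TangentSpace 𝓘(ℝ, E) x) (γ : ℝ → M) : Prop :=
  (∃ ε > 0, IsGeodesicOn (E := E) γ (Ioo (-ε) (1 + ε))) ∧
    (⟨γ 0, mfderiv 𝓘(ℝ, ℝ) 𝓘(ℝ, E) γ 0 (1 : ℝ)⟩ : TangentBundle 𝓘(ℝ, E) M) = ⟨x, v⟩

/-- The domain of the exponential map at `x`. -/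
def expDomain (x : M) : Set (TangentSpace 𝓘(ℝ, E) x) :=
  {v | ∃ γ, IsGeodesicFrom x v γ}

open Classical in
/-- The geodesic exponential map at `x`: it sends `v` to `γ 1`, where `γ` is the geodesic that
starts at `x` with velocity `v`. Outside of `expDomain x` the value is irrelevant. -/
def expMap (x : M) (v : TangentSpace 𝓘(ℝ, E) x) : M :=
  if h : ∃ γ, IsGeodesicFrom x v γ then h.choose 1 else x

/-- The kernel of the differential of the exponential map at `v`. -/
def expKer (x : M) (v : TangentSpace 𝓘(ℝ, E) x) : Submodule ℝ (TangentSpace 𝓘(ℝ, E) x) :=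
  LinearMap.ker (mfderiv 𝓘(ℝ, TangentSpace 𝓘(ℝ, E) x) 𝓘(ℝ, E) (expMap x) v).toLinearMap

/-- `x` and `expMap x v` are conjugate points along the geodesic with initial velocity `v`:
`v` is a critical point of the exponential map at `x`. -/
def IsConjugateAlong (x : M) (v : TangentSpace 𝓘(ℝ, E) x) : Prop :=
  v ∈ expDomain x ∧ expKer x v ≠ ⊥

/-- The multiplicity of `x` and `expMap x v` as conjugate points along the geodesic with initial
velocity `v`. -/
def conjMultiplicity (x : M) (v : TangentSpace 𝓘(ℝ, E) x) : ℕ :=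
  finrank ℝ (expKer x v)

variable (E) in
/-- The set of all points conjugate to `x`. -/
def conjugateLocus (x : M) : Set M :=
  {X | ∃ v : TangentSpace 𝓘(ℝ, E) x, IsConjugateAlong x v ∧ expMap x v = X}

end Geodesics

/-! ### The Hamiltonian boundary value problem on the cotangent bundle -/

variable [IsManifold 𝓘(ℝ, E) ∞ M]

variable (E M) in
/-- The cotangent bundle of `M`, with its structure of a manifold. -/
abbrev CotangentBundle : Type _ :=
  TotalSpace (E →L[ℝ] ℝ) (fun x : M ↦ TangentSpace 𝓘(ℝ, E) x →L[ℝ] Trivial M ℝ x)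

variable (E) in
/-- The model with corners of the cotangent bundle. -/
abbrev cotangentModel : ModelWithCorners ℝ (E × (E →L[ℝ] ℝ)) (ModelProd E (E →L[ℝ] ℝ)) :=
  𝓘(ℝ, E).prod 𝓘(ℝ, E →L[ℝ] ℝ)

/-- The standard symplectic form `∑ dxʲ ∧ dyⱼ` on `T*V = V × V*`. -/
def stdSymplectic {V : Type*} [NormedAddCommGroup V] [NormedSpace ℝ V]
    (a b : V × (V →L[ℝ] ℝ)) : ℝ :=
  b.2 a.1 - a.2 b.1

/-- The canonical coordinates `(x, y)` on the cotangent bundle induced by the chart of `M` centred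
at `c`: `x` are the coordinates of the base point and `y` those of the covector. -/
def canonicalCoords (c : M) (α : CotangentBundle E M) : E × (E →L[ℝ] ℝ) :=
  (extChartAt 𝓘(ℝ, E) c α.proj,
    letI y : TangentSpace 𝓘(ℝ, E) α.proj →L[ℝ] ℝ := α.2
    letI D : E →L[ℝ] TangentSpace 𝓘(ℝ, E) α.proj :=
      mfderiv 𝓘(ℝ, E) 𝓘(ℝ, E) (extChartAt 𝓘(ℝ, E) c).symm (extChartAt 𝓘(ℝ, E) c α.proj)
    y ∘L D)

/-- The canonical symplectic form of the cotangent bundle at `α`. -/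
def cotangentSymplectic (α : CotangentBundle E M)
    (ξ η : TangentSpace (cotangentModel E) α) : ℝ :=
  letI D : TangentSpace (cotangentModel E) α →L[ℝ] E × (E →L[ℝ] ℝ) :=
    mfderiv (cotangentModel E) 𝓘(ℝ, E × (E →L[ℝ] ℝ)) (canonicalCoords α.proj) α
  stdSymplectic (D ξ) (D η)

section Hamiltonian

variable [FiniteDimensional ℝ E] [RiemannianBundle (fun x : M ↦ TangentSpace 𝓘(ℝ, E) x)]

/-- The geodesic Hamiltonian `H(α) = α(g⁻¹ α) / 2`. -/
def geodesicHamiltonian (α : CotangentBundle E M) : ℝ :=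
  letI y : TangentSpace 𝓘(ℝ, E) α.proj →L[ℝ] ℝ := α.2
  haveI : FiniteDimensional ℝ (TangentSpace 𝓘(ℝ, E) α.proj) :=
    inferInstanceAs (FiniteDimensional ℝ E)
  haveI : CompleteSpace (TangentSpace 𝓘(ℝ, E) α.proj) := FiniteDimensional.complete ℝ _
  y ((InnerProductSpace.toDual ℝ (TangentSpace 𝓘(ℝ, E) α.proj)).symm y) / 2

/-- `a` is a motion of the Hamiltonian system on the open set `J` of times: its velocity at each
`t ∈ J` is the Hamiltonian vector field `X_H`, given by `ω(X_H, ·) = dH`. -/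
def IsHamiltonianMotionOn (a : ℝ → CotangentBundle E M) (J : Set ℝ) : Prop :=
  ∀ t ∈ J, ∃ ξ : TangentSpace (cotangentModel E) (a t),
    HasMFDerivAt 𝓘(ℝ, ℝ) (cotangentModel E) a t ((1 : ℝ →L[ℝ] ℝ).smulRight ξ) ∧
    ∀ η : TangentSpace (cotangentModel E) (a t),
      cotangentSymplectic (a t) ξ η
        = mfderiv (cotangentModel E) 𝓘(ℝ, ℝ) geodesicHamiltonian (a t) η

variable (E M) in
/-- The graph of the time-1-map of the Hamiltonian flow. -/
def flowGraph : Set (CotangentBundle E M × CotangentBundle E M) :=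
  {p | ∃ ε > 0, ∃ a : ℝ → CotangentBundle E M,
    IsHamiltonianMotionOn a (Ioo (-ε) (1 + ε)) ∧ a 0 = p.1 ∧ a 1 = p.2}

end Hamiltonian

variable (E) in
/-- The boundary condition `π(α) = x`, `π(β) = X`. -/
def boundarySet (x X : M) : Set (CotangentBundle E M × CotangentBundle E M) :=
  {p | p.1.proj = x ∧ p.2.proj = X}

/-- `Ψ` is a local symplectomorphism from `(T*M × T*M, ω ⊕ -ω)` to `T*W`, where the space
`W = E × E` has the dimension of `T*M`. -/
def IsLocalSymplectomorphism
    (Ψ : OpenPartialHomeomorph (CotangentBundle E M × CotangentBundle E M)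
      ((E × E) × ((E × E) →L[ℝ] ℝ))) : Prop :=
  ContMDiffOn ((cotangentModel E).prod (cotangentModel E)) 𝓘(ℝ, (E × E) × ((E × E) →L[ℝ] ℝ)) ∞
    Ψ Ψ.source ∧
  ContMDiffOn 𝓘(ℝ, (E × E) × ((E × E) →L[ℝ] ℝ)) ((cotangentModel E).prod (cotangentModel E)) ∞
    Ψ.symm Ψ.target ∧
  ∀ p ∈ Ψ.source, ∀ ξ η : TangentSpace (cotangentModel E) p.1 × TangentSpace (cotangentModel E) p.2,
    letI D : TangentSpace (cotangentModel E) p.1 × TangentSpace (cotangentModel E) p.2 →L[ℝ]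
        (E × E) × ((E × E) →L[ℝ] ℝ) :=
      mfderiv ((cotangentModel E).prod (cotangentModel E))
        𝓘(ℝ, (E × E) × ((E × E) →L[ℝ] ℝ)) Ψ p
    stdSymplectic (D ξ) (D η)
      = cotangentSymplectic p.1 ξ.1 η.1 - cotangentSymplectic p.2 ξ.2 η.2

/-- `m` is the degeneracy of the singularity, at the solution `p`, of the boundary value problem
given by the graph `Γ` of a symplectic map and the boundary condition `B`: a local
symplectomorphism to a cotangent bundle turns `Γ` and `B`, near `p`, into the images of exact
1-forms `df` and `dh`, and the Hessian of `f - h` at the base point corresponding to `p` has a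
kernel of dimension `m`. -/
def HasDegeneracy (Γ B : Set (CotangentBundle E M × CotangentBundle E M))
    (p : CotangentBundle E M × CotangentBundle E M) (m : ℕ) : Prop :=
  ∃ (Ψ : OpenPartialHomeomorph (CotangentBundle E M × CotangentBundle E M)
      ((E × E) × ((E × E) →L[ℝ] ℝ))) (D : Set (E × E)) (f h : E × E → ℝ),
    IsLocalSymplectomorphism Ψ ∧ p ∈ Ψ.source ∧
    IsOpen D ∧ ContDiffOn ℝ ∞ f D ∧ ContDiffOn ℝ ∞ h D ∧
    Ψ '' (Γ ∩ Ψ.source) = (fun w ↦ (w, fderiv ℝ f w)) '' D ∧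
    Ψ '' (B ∩ Ψ.source) = (fun w ↦ (w, fderiv ℝ h w)) '' D ∧
    finrank ℝ (LinearMap.ker
      (fderiv ℝ (fun w ↦ fderiv ℝ (fun w' ↦ f w' - h w') w) (Ψ p).1).toLinearMap) = m

end ConjugatePoints

end

/-!
Differentiable dependence on initial values makes `exp_x` differentiable on its domain. For `w ≠ 0`,
`d(exp_x)_{sw} w` is the velocity at time `s` of the geodesic `t ↦ exp_x (t w)`, which never
vanishes. Every `v` in the domain is of the form `s w` (take `s = 0` for `v = 0`), so the kernel of
`d(exp_x)_v` is a proper subspace, which is (i).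

For (ii), a vector in the kernel of the Hessian of `f - h` gives a common tangent direction of the
graphs of `df` and `dh`. Moved back by the symplectomorphism it becomes a vector tangent to both `Γ`
and `T_x^*N × T_X^*N`: a variation of `α` inside its fibre for which the endpoint of the Hamiltonian
motion does not move to first order. The musical isomorphism turns Hamiltonian motions into
velocities of geodesics, so the variation of the initial velocity lies in the kernel of `d(exp_x)`.
This assignment is injective, hence the degeneracy is at most the multiplicity of `x` and `X` along
the geodesic, which is at most `n - 1` by (i).
-/

noncomputable section

namespace ConjugatePoints

open Filter Metric

/-! ### Differentiable dependence of the solutions of an ODE on the initial value -/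

section DifferentiableDependence

open NNReal

variable {F G : Type*} [NormedAddCommGroup F] [NormedSpace ℝ F]
  [NormedAddCommGroup G] [NormedSpace ℝ G]

theorem norm_sub_sub_fderiv_le_of_lipschitzOnWith {f : F → G} {s : Set F} (hs : Convex ℝ s)
    (hf : ∀ x ∈ s, DifferentiableAt ℝ f x) {C : ℝ≥0} (hC : LipschitzOnWith C (fderiv ℝ f) s)
    {a b : F} (ha : a ∈ s) (hb : b ∈ s) :
    ‖f b - f a - fderiv ℝ f a (b - a)‖ ≤ C * ‖b - a‖ ^ 2 := by
  have hsub : segment ℝ a b ⊆ s := hs.segment_subset ha hb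
  have hbound : ∀ x ∈ segment ℝ a b, ‖fderiv ℝ f x - fderiv ℝ f a‖ ≤ C * ‖b - a‖ := fun x hx ↦ by
    have hxa : ‖x - a‖ ≤ ‖b - a‖ := by
      simpa [dist_eq_norm, norm_sub_rev] using segment_subset_closedBall_left a b hx
    exact (hC.norm_sub_le (hsub hx) ha).trans (by gcongr)
  calc ‖f b - f a - fderiv ℝ f a (b - a)‖ ≤ C * ‖b - a‖ * ‖b - a‖ :=
        (convex_segment a b).norm_image_sub_le_of_norm_hasFDerivWithin_le'
          (fun x hx ↦ (hf x (hsub hx)).hasFDerivAt.hasFDerivWithinAt) hbound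
          (left_mem_segment ℝ a b) (right_mem_segment ℝ a b)
    _ = C * ‖b - a‖ ^ 2 := by ring

theorem gronwallBound_zero_eq_mul (K c x : ℝ) :
    gronwallBound 0 K c x = c * gronwallBound 0 K 1 x := by
  by_cases hK : K = 0
  · simp [hK, gronwallBound_K0]
  · simp only [gronwallBound_of_K_ne_0 hK]; ring

variable {f : F → F} {s : Set F} {T : ℝ}

theorem norm_sub_le_mul_exp_of_hasDerivAt {K : ℝ≥0} (hK : LipschitzOnWith K f s) {σ τ : ℝ → F}
    (hσ : ∀ t ∈ Icc 0 T, σ t ∈ s ∧ HasDerivAt σ (f (σ t)) t)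
    (hτ : ∀ t ∈ Icc 0 T, τ t ∈ s ∧ HasDerivAt τ (f (τ t)) t) {t : ℝ} (ht : t ∈ Icc 0 T) :
    ‖τ t - σ t‖ ≤ ‖τ 0 - σ 0‖ * Real.exp (K * t) := by
  have h := dist_le_of_trajectories_ODE_of_mem (v := fun _ ↦ f) (s := fun _ ↦ s) (fun _ _ ↦ hK)
    (fun t ht ↦ (hτ t ht).2.continuousAt.continuousWithinAt)
    (fun t ht ↦ (hτ t (Ico_subset_Icc_self ht)).2.hasDerivWithinAt)
    (fun t ht ↦ (hτ t (Ico_subset_Icc_self ht)).1)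
    (fun t ht ↦ (hσ t ht).2.continuousAt.continuousWithinAt)
    (fun t ht ↦ (hσ t (Ico_subset_Icc_self ht)).2.hasDerivWithinAt)
    (fun t ht ↦ (hσ t (Ico_subset_Icc_self ht)).1) le_rfl t ht
  simpa only [dist_eq_norm, sub_zero] using h

theorem norm_sub_sub_variational_le (hs : Convex ℝ s) (hf : ∀ x ∈ s, DifferentiableAt ℝ f x)
    {K C : ℝ≥0} (hK : ∀ x ∈ s, ‖fderiv ℝ f x‖₊ ≤ K) (hC : LipschitzOnWith C (fderiv ℝ f) s)
    {σ τ : ℝ → F} {A : ℝ → F →L[ℝ] F}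
    (hσ : ∀ t ∈ Icc 0 T, σ t ∈ s ∧ HasDerivAt σ (f (σ t)) t)
    (hτ : ∀ t ∈ Icc 0 T, τ t ∈ s ∧ HasDerivAt τ (f (τ t)) t)
    (hA0 : A 0 = 1) (hA : ∀ t ∈ Icc 0 T, HasDerivAt A (fderiv ℝ f (σ t) ∘L A t) t)
    (hT : 0 ≤ T) :
    ‖τ T - σ T - A T (τ 0 - σ 0)‖
      ≤ C * Real.exp (K * T) ^ 2 * gronwallBound 0 K 1 T * ‖τ 0 - σ 0‖ ^ 2 := by
  set δ := τ 0 - σ 0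
  have hgrowth : ∀ t ∈ Icc 0 T, ‖τ t - σ t‖ ≤ ‖δ‖ * Real.exp (K * T) := fun t ht ↦
    (norm_sub_le_mul_exp_of_hasDerivAt (hs.lipschitzOnWith_of_nnnorm_fderiv_le hf hK)
      hσ hτ ht).trans (by have := ht.2; gcongr)
  -- The remainder `τ - σ - A δ` solves the variational equation up to the Taylor error of `f`.
  have hderiv : ∀ t ∈ Icc 0 T, HasDerivAt (fun t ↦ τ t - σ t - A t δ)
      (f (τ t) - f (σ t) - fderiv ℝ f (σ t) (A t δ)) t := fun t ht ↦ by
    simpa using ((hτ t ht).2.fun_sub (hσ t ht).2).fun_sub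
      ((hA t ht).clm_apply (hasDerivAt_const t δ))
  have hbound : ∀ t ∈ Ico 0 T, ‖f (τ t) - f (σ t) - fderiv ℝ f (σ t) (A t δ)‖
      ≤ K * ‖τ t - σ t - A t δ‖ + C * (‖δ‖ * Real.exp (K * T)) ^ 2 := fun t ht ↦ by
    replace ht := Ico_subset_Icc_self ht
    have hTaylor := norm_sub_sub_fderiv_le_of_lipschitzOnWith hs hf hC (hσ t ht).1 (hτ t ht).1
    have hlin := (fderiv ℝ f (σ t)).le_of_opNorm_le (hK _ (hσ t ht).1) (τ t - σ t - A t δ)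
    calc ‖f (τ t) - f (σ t) - fderiv ℝ f (σ t) (A t δ)‖
        = ‖fderiv ℝ f (σ t) (τ t - σ t - A t δ)
            + (f (τ t) - f (σ t) - fderiv ℝ f (σ t) (τ t - σ t))‖ := by
          congr 1; simp only [map_sub]; abel
      _ ≤ K * ‖τ t - σ t - A t δ‖ + C * ‖τ t - σ t‖ ^ 2 :=
          (norm_add_le _ _).trans (add_le_add hlin hTaylor)
      _ ≤ K * ‖τ t - σ t - A t δ‖ + C * (‖δ‖ * Real.exp (K * T)) ^ 2 := by
          gcongr; exact hgrowth t ht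
  calc ‖τ T - σ T - A T δ‖ ≤ gronwallBound 0 K (C * (‖δ‖ * Real.exp (K * T)) ^ 2) (T - 0) :=
        norm_le_gronwallBound_of_norm_deriv_right_le
          (fun t ht ↦ (hderiv t ht).continuousAt.continuousWithinAt)
          (fun t ht ↦ (hderiv t (Ico_subset_Icc_self ht)).hasDerivWithinAt)
          (by simp [hA0, δ]) hbound T (right_mem_Icc.2 hT)
    _ = C * Real.exp (K * T) ^ 2 * gronwallBound 0 K 1 T * ‖δ‖ ^ 2 := by
        rw [gronwallBound_zero_eq_mul, sub_zero]; ring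

theorem hasFDerivAt_flow_of_variational (hs : Convex ℝ s) (hf : ∀ x ∈ s, DifferentiableAt ℝ f x)
    {K C : ℝ≥0} (hK : ∀ x ∈ s, ‖fderiv ℝ f x‖₊ ≤ K) (hC : LipschitzOnWith C (fderiv ℝ f) s)
    {α : F → ℝ → F} {A : ℝ → F →L[ℝ] F} {x : F} (hT : 0 ≤ T) (hα0 : ∀ᶠ y in 𝓝 x, α y 0 = y)
    (hα : ∀ᶠ y in 𝓝 x, ∀ t ∈ Icc 0 T, α y t ∈ s ∧ HasDerivAt (α y) (f (α y t)) t)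
    (hA0 : A 0 = 1) (hA : ∀ t ∈ Icc 0 T, HasDerivAt A (fderiv ℝ f (α x t) ∘L A t) t) :
    HasFDerivAt (α · T) (A T) x := by
  have hquad : (fun y ↦ α y T - α x T - A T (y - x)) =O[𝓝 x] fun y ↦ ‖y - x‖ ^ 2 := by
    refine .of_bound (C * Real.exp (K * T) ^ 2 * gronwallBound 0 K 1 T) ?_
    filter_upwards [hα0, hα] with y hy0 hy
    simpa [hy0, hα0.self_of_nhds] using
      norm_sub_sub_variational_le hs hf hK hC hα.self_of_nhds hy hA0 hA hT
  exact hasFDerivAt_iff_isLittleO.2 <|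
    hquad.trans_isLittleO (Asymptotics.isLittleO_pow_sub_sub x one_lt_two)

variable [CompleteSpace F] {x₀ : F}

theorem exists_localFlow_mem (hf : ContDiffAt ℝ 1 f x₀) {U : Set F} (hU : U ∈ 𝓝 x₀) :
    ∃ ε > 0, ∃ r > 0, ∃ α : F → ℝ → F, ∀ x ∈ ball x₀ r, α x 0 = x ∧
      ∀ t ∈ Ioo (-ε) ε, α x t ∈ U ∧ HasDerivAt (α x) (f (α x t)) t := by
  obtain ⟨ε, hε, _, r, _, _, hr, hPL⟩ := IsPicardLindelof.of_contDiffAt_one hf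
  obtain ⟨β, hβ, hβc⟩ := (hPL 0).exists_forall_mem_closedBall_eq_hasDerivWithinAt_continuousOn
  have hβ0 : β (x₀, 0) = x₀ := (hβ x₀ (mem_closedBall_self hr.le)).1
  have hcont : ContinuousAt β (x₀, 0) := hβc.continuousAt <|
    prod_mem_nhds (closedBall_mem_nhds _ hr) (Icc_mem_nhds (by linarith) (by linarith))
  obtain ⟨δ, hδ, hδU⟩ := Metric.eventually_nhds_iff_ball.1 (hcont (by rwa [hβ0]))
  refine ⟨min δ ε, lt_min hδ hε, min δ r, lt_min hδ hr, fun x t ↦ β (x, t), fun x hx ↦ ?_⟩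
  have hxr : x ∈ closedBall x₀ r := ball_subset_closedBall (ball_subset_ball (min_le_right ..) hx)
  refine ⟨(hβ x hxr).1, fun t ht ↦ ⟨hδU (x, t) ?_, ?_⟩⟩
  · rw [← ball_prod_same, Real.ball_eq_Ioo]
    exact ⟨ball_subset_ball (min_le_left ..) hx, by grind, by grind⟩
  · exact ((hβ x hxr).2 t (by grind)).hasDerivAt (Icc_mem_nhds (by grind) (by grind))

theorem exists_localFlow_differentiableAt (hf : ContDiffAt ℝ 2 f x₀) {U : Set F}
    (hU : U ∈ 𝓝 x₀) :
    ∃ ε > 0, ∃ r > 0, ∃ α : F → ℝ → F, ∀ x ∈ ball x₀ r, α x 0 = x ∧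
      (∀ t ∈ Ioo (-ε) ε, α x t ∈ U ∧ HasDerivAt (α x) (f (α x t)) t) ∧
      ∀ t ∈ Ico 0 ε, DifferentiableAt ℝ (α · t) x := by
  have hf1 : ContDiffAt ℝ 1 f x₀ := hf.of_le (by norm_num)
  have hdf : ContDiffAt ℝ 1 (fderiv ℝ f) x₀ := hf.fderiv_right (by norm_num)
  obtain ⟨K, s, hs, hK⟩ := hf1.exists_lipschitzOnWith
  obtain ⟨C, s', hs', hC⟩ := hdf.exists_lipschitzOnWith
  have hdiff : ∀ᶠ x in 𝓝 x₀, DifferentiableAt ℝ f x :=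
    (hf.eventually (by simp)).mono fun x hx ↦ hx.differentiableAt (by simp)
  obtain ⟨ρ, hρ, hball⟩ := Metric.mem_nhds_iff.1
    (inter_mem (inter_mem hs hs') (inter_mem hdiff hU))
  have hfderiv_le : ∀ x ∈ ball x₀ ρ, ‖fderiv ℝ f x‖₊ ≤ K := fun x hx ↦
    norm_fderiv_le_of_lipschitzOn ℝ (mem_of_superset (isOpen_ball.mem_nhds hx)
      fun y hy ↦ (hball hy).1.1) hK
  -- The equation coupled with its variational equation: the second component is `∂α/∂x`.
  let g : F × (F →L[ℝ] F) → F × (F →L[ℝ] F) := fun p ↦ (f p.1, fderiv ℝ f p.1 ∘L p.2)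
  have hg : ContDiffAt ℝ 1 g (x₀, 1) :=
    (hf1.comp (x₀, (1 : F →L[ℝ] F)) contDiffAt_fst).prodMk
      ((hdf.comp (x₀, (1 : F →L[ℝ] F)) contDiffAt_fst).clm_comp contDiffAt_snd)
  obtain ⟨ε, hε, r, hr, β, hβ⟩ :=
    exists_localFlow_mem hg (continuousAt_fst.preimage_mem_nhds (ball_mem_nhds x₀ hρ))
  replace hβ : ∀ x ∈ ball x₀ r, _ := fun x hx ↦
    hβ (x, 1) (by rw [← ball_prod_same]; exact ⟨hx, mem_ball_self hr⟩)
  have hα0 : ∀ x ∈ ball x₀ r, (β (x, 1) 0).1 = x := fun x hx ↦ congrArg Prod.fst (hβ x hx).1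
  have hα : ∀ x ∈ ball x₀ r, ∀ t ∈ Ioo (-ε) ε, (β (x, 1) t).1 ∈ ball x₀ ρ ∧
      HasDerivAt (fun t ↦ (β (x, 1) t).1) (f (β (x, 1) t).1) t := fun x hx t ht ↦
    ⟨((hβ x hx).2 t ht).1, ((hβ x hx).2 t ht).2.fst⟩
  refine ⟨ε, hε, r, hr, fun x t ↦ (β (x, 1) t).1, fun x hx ↦ ⟨hα0 x hx, fun t ht ↦
    ⟨(hball (hα x hx t ht).1).2.2, (hα x hx t ht).2⟩, fun T hT ↦ ?_⟩⟩
  have hIcc : Icc 0 T ⊆ Ioo (-ε) ε := fun t ht ↦ by grind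
  have hev : ∀ᶠ y in 𝓝 x, y ∈ ball x₀ r := isOpen_ball.mem_nhds hx
  exact (hasFDerivAt_flow_of_variational (A := fun t ↦ (β (x, 1) t).2) (convex_ball x₀ ρ)
    (fun y hy ↦ (hball hy).2.1) hfderiv_le (hC.mono fun y hy ↦ (hball hy).1.2) hT.1
    (hev.mono hα0) (hev.mono fun y hy t ht ↦ hα y hy t (hIcc ht))
    (congrArg Prod.snd (hβ x hx).1)
    fun t ht ↦ ((hβ x hx).2 t (hIcc ht)).2.snd).differentiableAt

end DifferentiableDependence

/-! ### Flows of vector fields on manifolds -/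

section ManifoldFlow

theorem rel_of_locally_of_trans {α : Type*} [ConditionallyCompleteLinearOrder α]
    [TopologicalSpace α] [OrderTopology α] [DenselyOrdered α] {s : Set α} [s.OrdConnected]
    {R : α → α → Prop}
    (hloc : ∀ c ∈ s, ∃ U ∈ 𝓝 c, ∀ x ∈ U, ∀ y ∈ U, x ≤ y → R x y)
    (htrans : ∀ x ∈ s, ∀ y ∈ s, ∀ z ∈ s, x ≤ y → y ≤ z → R x y → R y z → R x z)
    {a b : α} (ha : a ∈ s) (hb : b ∈ s) (hab : a ≤ b) : R a b := by
  -- Preconnected induction needs a symmetric relation.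
  let P a b := ∀ x ∈ uIcc a b, ∀ y ∈ uIcc a b, x ≤ y → R x y
  have hsymm : ∀ {a b}, P a b → P b a := fun {a b} h ↦ by simpa only [P, uIcc_comm b a] using h
  have hcross : ∀ {a b c}, a ∈ s → b ∈ s → c ∈ s → P a b → P b c → ∀ x ∈ uIcc a b,
      ∀ y ∈ uIcc b c, x ≤ y → R x y := by
    intro a b c ha hb hc hab hbc x hx y hy hxy
    rcases lt_or_ge b x with hbx | hxb
    · exact hbc x (by grind [mem_uIcc]) y hy hxy
    rcases lt_or_ge y b with hyb | hby
    · exact hab x hx y (by grind [mem_uIcc]) hxy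
    exact htrans x (OrdConnected.uIcc_subset ‹_› ha hb hx) b hb y
      (OrdConnected.uIcc_subset ‹_› hb hc hy) hxb hby (hab x hx b right_mem_uIcc hxb)
      (hbc b left_mem_uIcc y hy hby)
  have hP : P a b := by
    refine ‹s.OrdConnected›.isPreconnected.induction₂ P (fun c hc ↦ ?_)
      (fun a b c ha hb hc hab hbc x hx y hy hxy ↦ ?_) (fun _ _ _ _ ↦ hsymm) ha hb
    · obtain ⟨U, hU, hR⟩ := hloc c hc
      filter_upwards [mem_nhdsWithin_of_mem_nhds ((tendsto_const_nhds.uIcc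
        tendsto_id).eventually (eventually_smallSets_subset.2 hU))] with b hb x hx y hy
        using hR x (hb hx) y (hb hy)
    · rcases uIcc_subset_uIcc_union_uIcc (b := b) hx with hx | hx <;>
      rcases uIcc_subset_uIcc_union_uIcc (b := b) hy with hy | hy
      · exact hab x hx y hy hxy
      · exact hcross ha hb hc hab hbc x hx y hy hxy
      · exact hcross hc hb ha (hsymm hbc) (hsymm hab) x (uIcc_comm b c ▸ hx) y
          (uIcc_comm a b ▸ hy) hxy
      · exact hbc x hx y hy hxy
  exact hP a left_mem_uIcc b right_mem_uIcc hab

variable {F : Type*} [NormedAddCommGroup F] [NormedSpace ℝ F]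
  {H : Type*} [TopologicalSpace H] {I : ModelWithCorners ℝ F H}
  {N : Type*} [TopologicalSpace N] [ChartedSpace H N]

theorem hasMFDerivAt_curve_iff {γ : ℝ → N} {t : ℝ} {ξ : TangentSpace I (γ t)} :
    HasMFDerivAt 𝓘(ℝ, ℝ) I γ t ((1 : ℝ →L[ℝ] ℝ).smulRight ξ) ↔
      ContinuousAt γ t ∧ HasDerivAt (F := F) (fun s ↦ extChartAt I (γ t) (γ s)) ξ t := by
  refine and_congr_right fun _ ↦ ?_
  have hiff (ζ : F) : HasFDerivWithinAt (fun s ↦ extChartAt I (γ t) (γ s))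
      ((1 : ℝ →L[ℝ] ℝ).smulRight ζ) (range (id : ℝ → ℝ)) t ↔
      HasDerivAt (fun s ↦ extChartAt I (γ t) (γ s)) ζ t := by
    rw [range_id, hasFDerivWithinAt_univ, hasDerivAt_iff_hasFDerivAt]
    rfl
  exact hiff ξ

variable {v : (x : N) → TangentSpace I x}

/-- `Φ` is the flow map of `v` from time `s` to time `t` near `z₀`, and it is differentiable
at `z₀`. -/
def IsFlowMapAt (v : (x : N) → TangentSpace I x) (s t : ℝ) (Φ : N → N) (z₀ : N) : Prop :=
  MDifferentiableAt I I Φ z₀ ∧ ∀ᶠ z in 𝓝 z₀, ∃ ε > 0, ∃ σ : ℝ → N,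
    IsMIntegralCurveOn σ v (Ioo (s - ε) (t + ε)) ∧ σ s = z ∧ σ t = Φ z

variable [IsManifold I 1 N]

theorem hasMFDerivAt_extChartAt_symm_comp {x₀ : N} {f : ℝ → F} {t : ℝ}
    (ht : f t ∈ interior (extChartAt I x₀).target)
    (h : HasDerivAt f (tangentCoordChange I ((extChartAt I x₀).symm (f t)) x₀
      ((extChartAt I x₀).symm (f t)) (v ((extChartAt I x₀).symm (f t)))) t) :
    HasMFDerivAt 𝓘(ℝ, ℝ) I (fun s ↦ (extChartAt I x₀).symm (f s)) t
      ((1 : ℝ →L[ℝ] ℝ).smulRight (v ((extChartAt I x₀).symm (f t)))) := by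
  have htarget : f t ∈ (extChartAt I x₀).target := interior_subset ht
  refine hasMFDerivAt_curve_iff.2
    ⟨(continuousAt_extChartAt_symm'' htarget).comp h.continuousAt, ?_⟩
  generalize hx : (extChartAt I x₀).symm (f t) = x at *
  have hx₀ : x ∈ (extChartAt I x₀).source := hx ▸ (extChartAt I x₀).map_target htarget
  have hself := mem_extChartAt_source (I := I) x
  have hchange : HasFDerivAt (extChartAt I x ∘ (extChartAt I x₀).symm)
      (tangentCoordChange I x₀ x x) (f t) := by
    have := hasFDerivWithinAt_tangentCoordChange (I := I) ⟨hx₀, hself⟩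
    rw [← hx, (extChartAt I x₀).right_inv htarget, hx] at this
    exact this.hasFDerivAt (mem_of_superset (isOpen_interior.mem_nhds ht)
      (interior_subset.trans (extChartAt_target_subset_range x₀)))
  exact (hchange.comp_hasDerivAt t h).congr_deriv
    ((tangentCoordChange_comp ⟨⟨hself, hx₀⟩, hself⟩).trans (tangentCoordChange_self hself))

variable [BoundarylessManifold I N]

theorem exists_localFlow_mdifferentiableAt [CompleteSpace F] {x₀ : N}
    (hv : ContMDiffAt I I.tangent 2 (fun x ↦ (⟨x, v x⟩ : TangentBundle I N)) x₀) :
    ∃ ε > 0, ∃ U ∈ 𝓝 x₀, ∃ β : N → ℝ → N, ∀ z ∈ U, β z 0 = z ∧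
      IsMIntegralCurveOn (β z) v (Ioo (-ε) ε) ∧
      ∀ t ∈ Ico 0 ε, MDifferentiableAt I I (β · t) z := by
  have hx : I.IsInteriorPoint x₀ := BoundarylessManifold.isInteriorPoint
  obtain ⟨ε, hε, r, hr, α, hα⟩ := exists_localFlow_differentiableAt
    ((contMDiffAt_iff.1 hv).2.contDiffAt (range_mem_nhds_isInteriorPoint hx)).snd
    (isOpen_interior.mem_nhds (I.isInteriorPoint_iff.1 hx))
  refine ⟨ε, hε, (extChartAt I x₀).source ∩ extChartAt I x₀ ⁻¹' ball (extChartAt I x₀ x₀) r,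
    inter_mem (extChartAt_source_mem_nhds x₀)
      ((continuousAt_extChartAt x₀).preimage_mem_nhds (ball_mem_nhds _ hr)),
    fun z t ↦ (extChartAt I x₀).symm (α (extChartAt I x₀ z) t), fun z ⟨hz, hzr⟩ ↦ ?_⟩
  obtain ⟨hα0, hα, hdiff⟩ := hα _ hzr
  refine ⟨by simpa only [hα0] using (extChartAt I x₀).left_inv hz, fun t ht ↦
    (hasMFDerivAt_extChartAt_symm_comp (hα t ht).1 (hα t ht).2).hasMFDerivWithinAt, fun t ht ↦ ?_⟩
  have hαt : α (extChartAt I x₀ z) t ∈ interior (extChartAt I x₀).target := (hα t (by grind)).1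
  have hsymm : MDifferentiableAt 𝓘(ℝ, F) I (extChartAt I x₀).symm (α (extChartAt I x₀ z) t) :=
    (mdifferentiableWithinAt_extChartAt_symm (interior_subset hαt)).mdifferentiableAt
      (mem_of_superset (isOpen_interior.mem_nhds hαt)
        (interior_subset.trans (extChartAt_target_subset_range x₀)))
  exact hsymm.comp z ((hdiff t ht).mdifferentiableAt.comp z
    (mdifferentiableAt_extChartAt (by rwa [← extChartAt_source I])))

theorem eventually_exists_isFlowMapAt [CompleteSpace F] {x₀ : N}
    (hv : ContMDiffAt I I.tangent 2 (fun x ↦ (⟨x, v x⟩ : TangentBundle I N)) x₀) :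
    ∃ ε > 0, ∀ᶠ z in 𝓝 x₀, ∀ s t, s ≤ t → t - s < ε → ∃ Φ, IsFlowMapAt v s t Φ z := by
  obtain ⟨ε, hε, U, hU, β, hβ⟩ := exists_localFlow_mdifferentiableAt hv
  refine ⟨ε, hε, (eventually_mem_nhds_iff.2 hU).mono fun z hz s t hst htε ↦
    ⟨fun z ↦ β z (t - s), (hβ z (mem_of_mem_nhds hz)).2.2 _ ⟨by linarith, htε⟩, ?_⟩⟩
  filter_upwards [hz] with z hz
  refine ⟨ε - (t - s), by linarith, β z ∘ (· + -s),
    ((hβ z hz).2.1.comp_add (-s)).mono fun u hu ↦ ?_, by simpa using (hβ z hz).1, rfl⟩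
  rw [mem_Ioo] at hu
  exact ⟨by linarith, by linarith⟩

variable [T2Space N]

theorem isMIntegralCurveOn_Ioo_eq_of_eq
    (hv : ContMDiff I I.tangent 1 (fun x ↦ (⟨x, v x⟩ : TangentBundle I N)))
    {σ τ : ℝ → N} {a b a' b' s t : ℝ} (hσ : IsMIntegralCurveOn σ v (Ioo a b))
    (hτ : IsMIntegralCurveOn τ v (Ioo a' b')) (hs : s ∈ Ioo a b) (hs' : s ∈ Ioo a' b')
    (ht : t ∈ Ioo a b) (ht' : t ∈ Ioo a' b') (h : σ s = τ s) : σ t = τ t :=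
  isMIntegralCurveOn_Ioo_eqOn_of_contMDiff_boundaryless (a := max a a') (b := min b b') (t₀ := s)
    ⟨max_lt hs.1 hs'.1, lt_min hs.2 hs'.2⟩ hv
    (hσ.mono (Ioo_subset_Ioo (le_max_left ..) (min_le_left ..)))
    (hτ.mono (Ioo_subset_Ioo (le_max_right ..) (min_le_right ..))) h
    ⟨max_lt ht.1 ht'.1, lt_min ht.2 ht'.2⟩

theorem IsFlowMapAt.eventually_apply_eq
    (hv : ContMDiff I I.tangent 1 (fun x ↦ (⟨x, v x⟩ : TangentBundle I N)))
    {s t : ℝ} {Φ : N → N} {z₀ : N} (hΦ : IsFlowMapAt v s t Φ z₀) (hst : s ≤ t) :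
    ∀ᶠ z in 𝓝 z₀, ∀ (σ : ℝ → N) (a b : ℝ), IsMIntegralCurveOn σ v (Ioo a b) → a < s → t < b →
      σ s = z → σ t = Φ z := by
  filter_upwards [hΦ.2] with z ⟨ε, hε, τ, hτ, hτs, hτt⟩ σ a b hσ has htb hσs
  rw [← hτt]
  exact isMIntegralCurveOn_Ioo_eq_of_eq hv hσ hτ (s := s) ⟨has, by linarith⟩
    ⟨by linarith, by linarith⟩ ⟨by linarith, htb⟩ ⟨by linarith, by linarith⟩ (hσs.trans hτs.symm)

theorem IsFlowMapAt.comp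
    (hv : ContMDiff I I.tangent 1 (fun x ↦ (⟨x, v x⟩ : TangentBundle I N)))
    {r s t : ℝ} {Φ Φ' : N → N} {z₀ : N} (hrs : r ≤ s) (hst : s ≤ t)
    (hΦ : IsFlowMapAt v r s Φ z₀) (hΦ' : IsFlowMapAt v s t Φ' (Φ z₀)) :
    IsFlowMapAt v r t (Φ' ∘ Φ) z₀ := by
  refine ⟨hΦ'.1.comp z₀ hΦ.1, ?_⟩
  filter_upwards [hΦ.2, hΦ.1.continuousAt.eventually hΦ'.2] with z ⟨ε, hε, σ, hσ, hσr, hσs⟩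
    ⟨δ, hδ, τ, hτ, hτs, hτt⟩
  have hs : s ∈ Ioo (r - ε) (s + ε) ∩ Ioo (s - δ) (t + δ) :=
    ⟨⟨by linarith, by linarith⟩, ⟨by linarith, by linarith⟩⟩
  have heq : σ s = τ s := hσs.trans hτs.symm
  refine ⟨min ε δ, lt_min hε hδ, piecewise (Ioo (r - ε) (s + ε)) σ τ, ?_, ?_, ?_⟩
  · exact (isMIntegralCurveOn_piecewise hv hσ hτ hs heq).mono fun u hu ↦ by
      rw [Ioo_union_Ioo] <;> grind
  · rw [piecewise_eq_of_mem _ _ _ (by constructor <;> linarith), hσr]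
  · rw [eqOn_piecewise_of_isMIntegralCurveOn_Ioo hv hσ hτ hs heq ⟨by linarith, by linarith⟩, hτt]
    rfl

theorem exists_isFlowMapAt_of_isMIntegralCurveOn [CompleteSpace F]
    (hv : ContMDiff I I.tangent 2 (fun x ↦ (⟨x, v x⟩ : TangentBundle I N)))
    {σ : ℝ → N} {a b s t : ℝ} (hσ : IsMIntegralCurveOn σ v (Ioo a b)) (has : a < s) (hst : s ≤ t)
    (htb : t < b) : ∃ Φ, IsFlowMapAt v s t Φ (σ s) := by
  have hv1 : ContMDiff I I.tangent 1 (fun x ↦ (⟨x, v x⟩ : TangentBundle I N)) :=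
    hv.of_le (by norm_num)
  refine rel_of_locally_of_trans (R := fun s t ↦ ∃ Φ, IsFlowMapAt v s t Φ (σ s)) (s := Ioo a b)
    (fun c hc ↦ ?_) ?_ ⟨has, by linarith⟩ ⟨by linarith, htb⟩ hst
  · have hcont : ContinuousAt σ c :=
      (hσ.continuousWithinAt hc).continuousAt (isOpen_Ioo.mem_nhds hc)
    obtain ⟨ε, hε, hΦ⟩ := eventually_exists_isFlowMapAt (hv (σ c))
    refine ⟨_, inter_mem (hcont.eventually hΦ) (ball_mem_nhds c (half_pos hε)),
      fun x hx y hy hxy ↦ hx.1 x y hxy ?_⟩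
    rw [Real.ball_eq_Ioo] at hx hy
    linarith [hx.2.1, hy.2.2]
  · rintro r hr s - t ht hrs hst ⟨Φ, hΦ⟩ ⟨Φ', hΦ'⟩
    refine ⟨Φ' ∘ Φ, hΦ.comp hv1 hrs hst ?_⟩
    rwa [← (hΦ.eventually_apply_eq hv1 hrs).self_of_nhds σ a b hσ hr.1 (by grind) rfl]

end ManifoldFlow

variable {E : Type*} [NormedAddCommGroup E] [NormedSpace ℝ E]
  {M : Type*} [TopologicalSpace M] [ChartedSpace E M] {c d y : M}

local notation "φ" => extChartAt 𝓘(ℝ, E)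

/-! ### The Riemannian metric in charts -/

section ChartMetric

/-- The change of coordinates from the chart at `c` to the chart at `d`. -/
def chartChange (c d : M) (u : E) : E := φ d ((φ c).symm u)

theorem chartChange_extChartAt (hc : y ∈ (φ c).source) : chartChange c d (φ c y) = φ d y :=
  congrArg (φ d) ((φ c).left_inv hc)

theorem nhds_extChartAt_eq_map (hc : y ∈ (φ c).source) : 𝓝 (φ c y) = map (φ c) (𝓝 y) := by
  rw [map_extChartAt_nhds' hc, ModelWithCorners.Boundaryless.range_eq_univ, nhdsWithin_univ]

section IsManifoldOne

variable [IsManifold 𝓘(ℝ, E) 1 M]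

theorem hasFDerivAt_chartChange (hc : y ∈ (φ c).source) (hd : y ∈ (φ d).source) :
    HasFDerivAt (chartChange c d) (tangentCoordChange 𝓘(ℝ, E) c d y) (φ c y) :=
  (hasFDerivWithinAt_tangentCoordChange ⟨hc, hd⟩).hasFDerivAt
    (by simp only [ModelWithCorners.Boundaryless.range_eq_univ, Filter.univ_mem])

theorem tangentCoordChange_tangentCoordChange_cancel (hc : y ∈ (φ c).source)
    (hd : y ∈ (φ d).source) (v : E) :
    tangentCoordChange 𝓘(ℝ, E) d c y (tangentCoordChange 𝓘(ℝ, E) c d y v) = v :=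
  (tangentCoordChange_comp ⟨⟨hc, hd⟩, hc⟩).trans (tangentCoordChange_self hc)

theorem mfderiv_extChartAt_symm_apply (hc : y ∈ (φ c).source) :
    (mfderiv 𝓘(ℝ, E) 𝓘(ℝ, E) (φ c).symm (φ c y) : E →L[ℝ] E) =
      tangentCoordChange 𝓘(ℝ, E) c y y := by
  have h : HasMFDerivAt 𝓘(ℝ, E) 𝓘(ℝ, E) (φ c).symm (φ c y)
      (tangentCoordChange 𝓘(ℝ, E) c y y : E →L[ℝ] E) := by
    refine ⟨continuousAt_extChartAt_symm' hc, ?_⟩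
    have := hasFDerivWithinAt_tangentCoordChange ⟨hc, mem_extChartAt_source (I := 𝓘(ℝ, E)) y⟩
    rwa [writtenInExtChartAt, (φ c).left_inv hc]
  exact h.mfderiv

end IsManifoldOne

section IsManifoldInfty

variable [IsManifold 𝓘(ℝ, E) ∞ M]

theorem contDiffAt_chartChange (hc : y ∈ (φ c).source) (hd : y ∈ (φ d).source) :
    ContDiffAt ℝ ∞ (chartChange c d) (φ c y) := by
  refine (contDiffWithinAt_ext_coord_change d c (n := ∞) ⟨(φ c).map_source hc, ?_⟩).contDiffAt
    (by simp only [ModelWithCorners.Boundaryless.range_eq_univ, Filter.univ_mem])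
  simpa only [mem_preimage, PartialEquiv.symm_symm, (φ c).left_inv hc] using hd

theorem contDiffAt_fderiv_chartChange (hc : y ∈ (φ c).source) (hd : y ∈ (φ d).source) :
    ContDiffAt ℝ ∞ (fderiv ℝ (chartChange c d)) (φ c y) :=
  (contDiffAt_chartChange hc hd).fderiv_right le_rfl

theorem hasFDerivAt_fderiv_chartChange (hc : y ∈ (φ c).source) (hd : y ∈ (φ d).source) :
    HasFDerivAt (fderiv ℝ (chartChange c d)) (fderiv ℝ (fderiv ℝ (chartChange c d)) (φ c y))
      (φ c y) :=
  ((contDiffAt_fderiv_chartChange hc hd).differentiableAt (by simp)).hasFDerivAt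

theorem fderiv_fderiv_chartChange_comm (hc : y ∈ (φ c).source) (hd : y ∈ (φ d).source) (v w : E) :
    fderiv ℝ (fderiv ℝ (chartChange c d)) (φ c y) v w =
      fderiv ℝ (fderiv ℝ (chartChange c d)) (φ c y) w v :=
  (contDiffAt_chartChange hc hd).isSymmSndFDerivAt
    (by simpa only [minSmoothness_of_isRCLikeNormedField] using ENat.LEInfty.out) v w

end IsManifoldInfty

variable [RiemannianBundle (fun x : M ↦ TangentSpace 𝓘(ℝ, E) x)]

/-- The inner product on the tangent space at `y`, on vectors given in the chart at `y`. -/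
def innerAt (y : M) (v w : E) : ℝ := inner (E := TangentSpace 𝓘(ℝ, E) y) ℝ v w

/-- The metric in a chart, as a continuous bilinear map. -/
def chartMetricL (c : M) (u : E) : E →L[ℝ] E →L[ℝ] ℝ :=
  letI D : E →L[ℝ] TangentSpace 𝓘(ℝ, E) ((φ c).symm u) := mfderiv 𝓘(ℝ, E) 𝓘(ℝ, E) (φ c).symm u
  (innerSL ℝ (E := TangentSpace 𝓘(ℝ, E) ((φ c).symm u))).bilinearComp D D

theorem chartMetricL_apply (c : M) (u v w : E) : chartMetricL c u v w = chartMetric c u v w := rfl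

theorem chartMetric_comm (c : M) (u v w : E) : chartMetric c u v w = chartMetric c u w v :=
  real_inner_comm _ _

theorem chartMetric_add_left (c : M) (u v v' w : E) :
    chartMetric c u (v + v') w = chartMetric c u v w + chartMetric c u v' w := by
  simp only [← chartMetricL_apply, map_add, add_apply]

theorem chartMetric_smul_left (c : M) (r : ℝ) (u v w : E) :
    chartMetric c u (r • v) w = r * chartMetric c u v w := by
  simp only [← chartMetricL_apply, map_smul, smul_apply, smul_eq_mul]

theorem chartMetric_eq_innerAt [IsManifold 𝓘(ℝ, E) 1 M] (hc : y ∈ (φ c).source) (v w : E) :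
    chartMetric c (φ c y) v w = innerAt y (tangentCoordChange 𝓘(ℝ, E) c y y v)
      (tangentCoordChange 𝓘(ℝ, E) c y y w) := by
  let D : E →L[ℝ] E := mfderiv 𝓘(ℝ, E) 𝓘(ℝ, E) (φ c).symm (φ c y)
  have h : chartMetric c (φ c y) v w = innerAt ((φ c).symm (φ c y)) (D v) (D w) := rfl
  have hD : D = tangentCoordChange 𝓘(ℝ, E) c y y := mfderiv_extChartAt_symm_apply hc
  rw [h, hD, (φ c).left_inv hc]

theorem chartMetric_tangentCoordChange [IsManifold 𝓘(ℝ, E) 1 M] (hc : y ∈ (φ c).source)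
    (hd : y ∈ (φ d).source) (v w : E) :
    chartMetric d (φ d y) (tangentCoordChange 𝓘(ℝ, E) c d y v)
      (tangentCoordChange 𝓘(ℝ, E) c d y w) = chartMetric c (φ c y) v w := by
  have hy := mem_extChartAt_source (I := 𝓘(ℝ, E)) y
  rw [chartMetric_eq_innerAt hc, chartMetric_eq_innerAt hd, tangentCoordChange_comp ⟨⟨hc, hd⟩, hy⟩,
    tangentCoordChange_comp ⟨⟨hc, hd⟩, hy⟩]

theorem eq_zero_of_chartMetric_self_eq_zero [IsManifold 𝓘(ℝ, E) 1 M] {u v : E}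
    (hu : u ∈ (φ c).target) (h : chartMetric c u v v = 0) : v = 0 := by
  obtain ⟨y, hc, rfl⟩ : ∃ y ∈ (φ c).source, φ c y = u :=
    ⟨_, (φ c).map_target hu, (φ c).right_inv hu⟩
  have h0 : tangentCoordChange 𝓘(ℝ, E) c y y v = 0 :=
    (inner_self_eq_zero (𝕜 := ℝ) (E := TangentSpace 𝓘(ℝ, E) y)).1
      ((chartMetric_eq_innerAt hc v v).symm.trans h)
  rw [← tangentCoordChange_tangentCoordChange_cancel hc (mem_extChartAt_source y) v, h0, map_zero]

section FiniteDimensional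

variable [FiniteDimensional ℝ E]

/-- The inverse metric in a chart. -/
def chartSharp (c : M) (u : E) : (E →L[ℝ] ℝ) →L[ℝ] E := (chartMetricL c u).inverse

variable [IsManifold 𝓘(ℝ, E) 1 M] {u : E}

theorem isInvertible_chartMetricL (hu : u ∈ (φ c).target) : (chartMetricL c u).IsInvertible := by
  have hinj : Function.Injective (chartMetricL c u).toLinearMap :=
    (injective_iff_map_eq_zero _).2 fun v hv ↦
      eq_zero_of_chartMetric_self_eq_zero hu (congrArg (fun f : E →L[ℝ] ℝ ↦ f v) hv)
  have hdim : finrank ℝ E = finrank ℝ (E →L[ℝ] ℝ) :=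
    (Subspace.dual_finrank_eq (K := ℝ) (V := E)).symm.trans
      (LinearMap.toContinuousLinearMap (𝕜 := ℝ) (E := E) (F' := ℝ)).finrank_eq
  exact ⟨(LinearEquiv.ofInjectiveOfFinrankEq _ hinj hdim).toContinuousLinearEquiv, rfl⟩

theorem chartSharp_chartMetricL (hu : u ∈ (φ c).target) (v : E) :
    chartSharp c u (chartMetricL c u v) = v :=
  (isInvertible_chartMetricL hu).inverse_apply_eq.2 rfl

theorem chartMetricL_chartSharp (hu : u ∈ (φ c).target) (η : E →L[ℝ] ℝ) :
    chartMetricL c u (chartSharp c u η) = η :=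
  ((isInvertible_chartMetricL hu).inverse_apply_eq.1 rfl).symm

end FiniteDimensional

variable [IsManifold 𝓘(ℝ, E) ∞ M]
  [IsContMDiffRiemannianBundle 𝓘(ℝ, E) ∞ E (fun x : M ↦ TangentSpace 𝓘(ℝ, E) x)] {u : E}

theorem contDiffOn_chartMetric (v w : E) :
    ContDiffOn ℝ ∞ (fun u ↦ chartMetric c u v w) (φ c).target := by
  let frame (v : E) (u : E) : TangentSpace 𝓘(ℝ, E) ((φ c).symm u) :=
    mfderiv 𝓘(ℝ, E) 𝓘(ℝ, E) (φ c).symm u v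
  have hframe (v : E) : ContMDiffOn 𝓘(ℝ, E) 𝓘(ℝ, E).tangent ∞
      (fun u ↦ (⟨(φ c).symm u, frame v u⟩ : TangentBundle 𝓘(ℝ, E) M)) (φ c).target := by
    have hsection : ContMDiff 𝓘(ℝ, E) 𝓘(ℝ, E).tangent ∞
        (fun u : E ↦ (⟨u, v⟩ : TangentBundle 𝓘(ℝ, E) E)) :=
      contMDiff_vectorSpace_iff_contDiff.2 contDiff_const
    refine (((contMDiffOn_extChartAt_symm (n := ∞) c).contMDiffOn_tangentMapWithin (m := ∞) le_rfl
      (isOpen_extChartAt_target c).uniqueMDiffOn).comp hsection.contMDiffOn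
        (fun u hu ↦ hu)).congr fun u hu ↦ ?_
    simp only [Function.comp_apply, tangentMapWithin,
      mfderivWithin_of_isOpen (isOpen_extChartAt_target c) hu, frame]
  rw [← contMDiffOn_iff_contDiffOn]
  exact ContMDiffOn.inner_bundle (IB := 𝓘(ℝ, E)) (F := E)
    (E := fun x : M ↦ TangentSpace 𝓘(ℝ, E) x) (b := (φ c).symm) (v := frame v) (w := frame w)
    (hframe v) (hframe w)

variable [FiniteDimensional ℝ E]

theorem contDiffAt_chartMetricL (hu : u ∈ (φ c).target) : ContDiffAt ℝ ∞ (chartMetricL c) u := by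
  have h : ContDiffOn ℝ ∞ (chartMetricL c) (φ c).target :=
    contDiffOn_clm_apply.2 fun v ↦ contDiffOn_clm_apply.2 fun w ↦ contDiffOn_chartMetric v w
  exact h.contDiffAt ((isOpen_extChartAt_target c).mem_nhds hu)

theorem hasFDerivAt_chartMetricL (hu : u ∈ (φ c).target) :
    HasFDerivAt (chartMetricL c) (fderiv ℝ (chartMetricL c) u) u :=
  ((contDiffAt_chartMetricL hu).differentiableAt (by simp)).hasFDerivAt

theorem contDiffAt_chartSharp (hu : u ∈ (φ c).target) : ContDiffAt ℝ ∞ (chartSharp c) u :=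
  have : CompleteSpace E := FiniteDimensional.complete ℝ E
  (isInvertible_chartMetricL hu).contDiffAt_map_inverse.comp u (contDiffAt_chartMetricL hu)

end ChartMetric

/-! ### The geodesic equation in charts -/

section Acceleration

variable [RiemannianBundle (fun x : M ↦ TangentSpace 𝓘(ℝ, E) x)]

-- Shortcuts: the bundle metric instance makes the search for these norms very slow.
local instance : NormedAddCommGroup (E →L[ℝ] E →L[ℝ] ℝ) :=
  ContinuousLinearMap.toNormedAddCommGroup

local instance : NormedSpace ℝ (E →L[ℝ] E →L[ℝ] ℝ) := ContinuousLinearMap.toNormedSpace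

local instance : NormedAddCommGroup (E →L[ℝ] E →L[ℝ] E →L[ℝ] ℝ) :=
  ContinuousLinearMap.toNormedAddCommGroup (E := E) (F := E →L[ℝ] E →L[ℝ] ℝ)

local instance : NormedSpace ℝ (E →L[ℝ] E →L[ℝ] E →L[ℝ] ℝ) :=
  ContinuousLinearMap.toNormedSpace (E := E) (F := E →L[ℝ] E →L[ℝ] ℝ)

/-- The Christoffel symbol of the first kind on the diagonal, as the covector
`z ↦ christoffel c u w w z`. -/
def christoffelForm (c : M) (u w : E) : E →L[ℝ] ℝ :=
  fderiv ℝ (chartMetricL c) u w w - (1 / 2 : ℝ) • ((fderiv ℝ (chartMetricL c) u).flip w).flip w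

theorem christoffelForm_eq (c : M) (u w z : E) :
    christoffelForm c u w z =
      fderiv ℝ (chartMetricL c) u w w z - 1 / 2 * fderiv ℝ (chartMetricL c) u z w w := rfl

variable [FiniteDimensional ℝ E]

/-- The acceleration, in the chart at `c`, of a geodesic at the point `u` with velocity `w`. -/
def geodesicAcc (c : M) (u w : E) : E := -chartSharp c u (christoffelForm c u w)

variable [IsManifold 𝓘(ℝ, E) ∞ M]
  [IsContMDiffRiemannianBundle 𝓘(ℝ, E) ∞ E (fun x : M ↦ TangentSpace 𝓘(ℝ, E) x)] {u : E}

theorem fderiv_chartMetric (hu : u ∈ (φ c).target) (v w z : E) :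
    fderiv ℝ (fun u' ↦ chartMetric c u' v w) u z = fderiv ℝ (chartMetricL c) u z v w := by
  have h : HasFDerivAt (fun u' ↦ chartMetric c u' v w) _ u :=
    ((hasFDerivAt_chartMetricL hu).clm_apply (hasFDerivAt_const v u)).clm_apply
      (hasFDerivAt_const w u)
  rw [h.fderiv]
  simp

theorem christoffelForm_apply (hu : u ∈ (φ c).target) (w z : E) :
    christoffelForm c u w z = christoffel c u w w z := by
  rw [christoffelForm_eq, christoffel, fderiv_chartMetric hu, fderiv_chartMetric hu]
  ring

theorem geodesic_equation_iff (hu : u ∈ (φ c).target) (a w : E) :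
    (∀ z, chartMetric c u a z + christoffel c u w w z = 0) ↔ a = geodesicAcc c u w := by
  have hform : (∀ z, chartMetric c u a z + christoffel c u w w z = 0) ↔
      chartMetricL c u a = -christoffelForm c u w := by
    simp only [ContinuousLinearMap.ext_iff, neg_apply, christoffelForm_apply hu,
      chartMetricL_apply, ← eq_neg_iff_add_eq_zero]
  rw [hform, geodesicAcc, ← map_neg]
  constructor
  · rintro h
    rw [← h, chartSharp_chartMetricL hu]
  · rintro rfl
    exact chartMetricL_chartSharp hu _

theorem contDiffAt_geodesicAcc (hu : u ∈ (φ c).target) (w : E) :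
    ContDiffAt ℝ ∞ (fun p : E × E ↦ geodesicAcc c p.1 p.2) (u, w) := by
  have hD : ContDiffOn ℝ ∞ (fun p : E × E ↦ fderiv ℝ (chartMetricL c) p.1)
      (Prod.fst ⁻¹' (φ c).target) := fun p hp ↦
    (((contDiffAt_chartMetricL hp).fderiv_right (m := ∞) le_rfl).comp p
      contDiffAt_fst).contDiffWithinAt
  have hform : ContDiffOn ℝ ∞ (fun p : E × E ↦ christoffelForm c p.1 p.2)
      (Prod.fst ⁻¹' (φ c).target) :=
    contDiffOn_clm_apply.2 fun z ↦
      (((hD.clm_apply contDiffOn_snd).clm_apply contDiffOn_snd).clm_apply contDiffOn_const).sub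
        (contDiffOn_const.mul (((hD.clm_apply contDiffOn_const).clm_apply
          contDiffOn_snd).clm_apply contDiffOn_snd))
  have hsharp : ContDiffAt ℝ ∞ (fun p : E × E ↦ chartSharp c p.1) (u, w) :=
    ContDiffAt.comp (g := chartSharp c) (f := Prod.fst) (u, w) (contDiffAt_chartSharp hu)
      contDiffAt_fst
  exact (hsharp.clm_apply (hform.contDiffAt
    (((isOpen_extChartAt_target c).preimage continuous_fst).mem_nhds hu))).neg

theorem fderiv_chartMetricL_tangentCoordChange (hc : y ∈ (φ c).source) (hd : y ∈ (φ d).source)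
    (a v z : E) :
    letI T := tangentCoordChange 𝓘(ℝ, E) c d y
    letI B := fderiv ℝ (fderiv ℝ (chartChange c d)) (φ c y)
    fderiv ℝ (chartMetricL c) (φ c y) a v z =
      fderiv ℝ (chartMetricL d) (φ d y) (T a) (T v) (T z) +
        chartMetric d (φ d y) (B a v) (T z) + chartMetric d (φ d y) (T v) (B a z) := by
  let F : E → E →L[ℝ] E := fderiv ℝ (chartChange c d)
  have hlaw : (fun u ↦ chartMetricL d (chartChange c d u) (F u v) (F u z)) =ᶠ[𝓝 (φ c y)]
      fun u ↦ chartMetric c u v z := by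
    rw [EventuallyEq, nhds_extChartAt_eq_map hc, eventually_map]
    filter_upwards [extChartAt_source_mem_nhds' (I := 𝓘(ℝ, E)) hc,
      extChartAt_source_mem_nhds' (I := 𝓘(ℝ, E)) hd] with x hxc hxd
    simp only [F, chartChange_extChartAt hxc, (hasFDerivAt_chartChange hxc hxd).fderiv]
    exact chartMetric_tangentCoordChange hxc hxd v z
  have hG : HasFDerivAt (chartMetricL d) (fderiv ℝ (chartMetricL d) (φ d y))
      (chartChange c d (φ c y)) := by
    rw [chartChange_extChartAt hc]
    exact hasFDerivAt_chartMetricL ((φ d).map_source hd)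
  have hF' := hasFDerivAt_fderiv_chartChange hc hd
  have hderiv := ((hG.comp _ (hasFDerivAt_chartChange hc hd)).clm_apply
    (hF'.clm_apply (hasFDerivAt_const v _))).clm_apply (hF'.clm_apply (hasFDerivAt_const z _))
  rw [← fderiv_chartMetric ((φ c).map_source hc), ← hlaw.fderiv_eq]
  refine (congrArg (· a) hderiv.fderiv).trans ?_
  simp only [add_apply, ContinuousLinearMap.comp_apply, ContinuousLinearMap.flip_apply, zero_apply,
    map_zero, zero_add, Function.comp_apply, chartMetricL_apply, chartChange_extChartAt hc,
    (hasFDerivAt_chartChange hc hd).fderiv]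
  ring

-- Koszul's cancellation: the terms with `B w z` drop out because `B` is symmetric.
theorem christoffelForm_tangentCoordChange (hc : y ∈ (φ c).source) (hd : y ∈ (φ d).source)
    (w z : E) :
    letI T := tangentCoordChange 𝓘(ℝ, E) c d y
    letI B := fderiv ℝ (fderiv ℝ (chartChange c d)) (φ c y)
    christoffelForm c (φ c y) w z =
      christoffelForm d (φ d y) (T w) (T z) + chartMetric d (φ d y) (B w w) (T z) := by
  simp only [christoffelForm_eq, fderiv_chartMetricL_tangentCoordChange hc hd,
    fderiv_fderiv_chartChange_comm hc hd z w]
  rw [chartMetric_comm d _ (tangentCoordChange 𝓘(ℝ, E) c d y w)]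
  ring

theorem geodesicAcc_tangentCoordChange (hc : y ∈ (φ c).source) (hd : y ∈ (φ d).source) (w : E) :
    letI T := tangentCoordChange 𝓘(ℝ, E) c d y
    geodesicAcc d (φ d y) (T w) =
      fderiv ℝ (fderiv ℝ (chartChange c d)) (φ c y) w w + T (geodesicAcc c (φ c y) w) := by
  have hd' := (φ d).map_source hd
  refine ((geodesic_equation_iff hd' _ _).1 fun z' ↦ ?_).symm
  obtain ⟨z, rfl⟩ : ∃ z, tangentCoordChange 𝓘(ℝ, E) c d y z = z' :=
    ⟨_, tangentCoordChange_tangentCoordChange_cancel hd hc z'⟩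
  have hz := (geodesic_equation_iff ((φ c).map_source hc) _ w).2 rfl z
  rw [← christoffelForm_apply ((φ c).map_source hc), christoffelForm_tangentCoordChange hc hd,
    ← chartMetric_tangentCoordChange hc hd] at hz
  rw [chartMetric_add_left, ← christoffelForm_apply hd']
  linarith

end Acceleration

/-! ### The geodesic spray -/

section Velocity

/-- The curve in the tangent bundle given by a curve and its velocity. -/
def velocityLift (γ : ℝ → M) (t : ℝ) : TangentBundle 𝓘(ℝ, E) M :=
  ⟨γ t, mfderiv 𝓘(ℝ, ℝ) 𝓘(ℝ, E) γ t (1 : ℝ)⟩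

variable {γ : ℝ → M} {t : ℝ}

theorem velocityLift_eq {ξ : TangentSpace 𝓘(ℝ, E) (γ t)}
    (h : HasMFDerivAt 𝓘(ℝ, ℝ) 𝓘(ℝ, E) γ t ((1 : ℝ →L[ℝ] ℝ).smulRight ξ)) :
    velocityLift γ t = ⟨γ t, ξ⟩ := by
  rw [velocityLift, h.mfderiv]
  exact congrArg (TotalSpace.mk (γ t)) (one_smul ℝ ξ)

theorem IsGeodesicOn.hasMFDerivAt [RiemannianBundle (fun x : M ↦ TangentSpace 𝓘(ℝ, E) x)]
    {J : Set ℝ} (h : IsGeodesicOn (E := E) γ J) (ht : t ∈ J) :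
    ∃ ξ : TangentSpace 𝓘(ℝ, E) (γ t),
      HasMFDerivAt 𝓘(ℝ, ℝ) 𝓘(ℝ, E) γ t ((1 : ℝ →L[ℝ] ℝ).smulRight ξ) :=
  ⟨_, hasMFDerivAt_curve_iff.2 ⟨(h t ht).1, (h t ht).2.1.self_of_nhds.hasDerivAt⟩⟩

theorem hasDerivAt_extChartAt_comp [IsManifold 𝓘(ℝ, E) 1 M] {ξ : TangentSpace 𝓘(ℝ, E) (γ t)}
    (hc : γ t ∈ (φ c).source)
    (h : HasMFDerivAt 𝓘(ℝ, ℝ) 𝓘(ℝ, E) γ t ((1 : ℝ →L[ℝ] ℝ).smulRight ξ)) :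
    HasDerivAt (fun s ↦ φ c (γ s)) (tangentCoordChange 𝓘(ℝ, E) (γ t) c (γ t) ξ) t := by
  obtain ⟨hcont, hderiv⟩ := hasMFDerivAt_curve_iff.1 h
  refine ((hasFDerivAt_chartChange (mem_extChartAt_source (γ t)) hc).comp_hasDerivAt t
    hderiv).congr_of_eventuallyEq ?_
  filter_upwards [hcont.eventually (extChartAt_source_mem_nhds (I := 𝓘(ℝ, E)) (γ t))] with s hs
  exact (chartChange_extChartAt hs).symm

end Velocity

section TangentBundleCharts

variable [IsManifold 𝓘(ℝ, E) ∞ M] {z z₀ : TangentBundle 𝓘(ℝ, E) M}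

/-- The vector of an element of the tangent bundle, in the chart at its base point. -/
def fiberVec (z : TangentBundle 𝓘(ℝ, E) M) : E := z.2

theorem extChartAt_tangentBundle (z₀ z : TangentBundle 𝓘(ℝ, E) M) :
    extChartAt 𝓘(ℝ, E).tangent z₀ z =
      (φ z₀.proj z.proj, tangentCoordChange 𝓘(ℝ, E) z.proj z₀.proj z.proj (fiberVec z)) := rfl

theorem extChartAt_tangentBundle_self (z : TangentBundle 𝓘(ℝ, E) M) :
    extChartAt 𝓘(ℝ, E).tangent z z = (φ z.proj z.proj, fiberVec z) := by
  rw [extChartAt_tangentBundle, tangentCoordChange_self (mem_extChartAt_source z.proj)]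

theorem mem_extChartAt_tangentBundle_source :
    z ∈ (extChartAt 𝓘(ℝ, E).tangent z₀).source ↔ z.proj ∈ (φ z₀.proj).source := by
  rw [extChartAt_source, extChartAt_source, TangentBundle.mem_chart_source_iff]

theorem extChartAt_tangentBundle_comp_symm (hz : z.proj ∈ (φ z₀.proj).source) :
    extChartAt 𝓘(ℝ, E).tangent z₀ ∘ (extChartAt 𝓘(ℝ, E).tangent z).symm
      =ᶠ[𝓝 (φ z.proj z.proj, fiberVec z)]
    fun p ↦ (chartChange z.proj z₀.proj p.1, fderiv ℝ (chartChange z.proj z₀.proj) p.1 p.2) := by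
  rw [← extChartAt_tangentBundle_self, EventuallyEq, ← map_extChartAt_nhds_of_boundaryless,
    eventually_map]
  filter_upwards [extChartAt_source_mem_nhds (I := 𝓘(ℝ, E).tangent) z,
    extChartAt_source_mem_nhds' (mem_extChartAt_tangentBundle_source.2 hz)] with ζ hζ hζ₀
  rw [Function.comp_apply, (extChartAt 𝓘(ℝ, E).tangent z).left_inv hζ]
  rw [mem_extChartAt_tangentBundle_source] at hζ hζ₀
  simp only [extChartAt_tangentBundle, chartChange_extChartAt hζ,
    (hasFDerivAt_chartChange hζ hζ₀).fderiv,
    tangentCoordChange_comp ⟨⟨mem_extChartAt_source ζ.proj, hζ⟩, hζ₀⟩]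

theorem tangentCoordChange_tangentBundle (hz : z.proj ∈ (φ z₀.proj).source) (a b : E) :
    letI T := tangentCoordChange 𝓘(ℝ, E) z.proj z₀.proj z.proj
    letI B := fderiv ℝ (fderiv ℝ (chartChange z.proj z₀.proj)) (φ z.proj z.proj)
    tangentCoordChange 𝓘(ℝ, E).tangent z z₀ z (a, b) = (T a, B a (fiberVec z) + T b) := by
  have hs := mem_extChartAt_source (I := 𝓘(ℝ, E)) z.proj
  have hT := hasFDerivAt_chartChange hs hz
  have hB := hasFDerivAt_fderiv_chartChange hs hz
  let p : E × E := (φ z.proj z.proj, fiberVec z)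
  have hderiv := (HasFDerivAt.comp (f := Prod.fst) p hT hasFDerivAt_fst).prodMk
    ((HasFDerivAt.comp (f := Prod.fst) p hB hasFDerivAt_fst).clm_apply hasFDerivAt_snd)
  have hfderiv := (hderiv.congr_of_eventuallyEq (extChartAt_tangentBundle_comp_symm hz)).fderiv
  rw [tangentCoordChange_def, ModelWithCorners.Boundaryless.range_eq_univ, fderivWithin_univ,
    extChartAt_tangentBundle_self]
  refine (congrArg (fun L : E × E →L[ℝ] E × E ↦ L (a, b)) hfderiv).trans ?_
  simp only [ContinuousLinearMap.prod_apply, ContinuousLinearMap.comp_apply,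
    ContinuousLinearMap.coe_fst', add_apply, ContinuousLinearMap.coe_snd',
    ContinuousLinearMap.flip_apply, Function.comp_apply, p, hT.fderiv, add_comm]

end TangentBundleCharts

section Spray

variable [IsManifold 𝓘(ℝ, E) ∞ M] [RiemannianBundle (fun x : M ↦ TangentSpace 𝓘(ℝ, E) x)]

/-- The geodesic spray, as a vector field on the tangent bundle. -/
def geodesicSpray (z : TangentBundle 𝓘(ℝ, E) M) : TangentSpace 𝓘(ℝ, E).tangent z :=
  ((fiberVec z, geodesicAcc z.proj (φ z.proj z.proj) (fiberVec z)) : E × E)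

variable {J : Set ℝ} {Z : ℝ → TangentBundle 𝓘(ℝ, E) M}

theorem hasMFDerivAt_proj_of_isMIntegralCurveOn (hJ : IsOpen J)
    (h : IsMIntegralCurveOn (I := 𝓘(ℝ, E).tangent) Z geodesicSpray J) {t : ℝ} (ht : t ∈ J) :
    HasMFDerivAt 𝓘(ℝ, ℝ) 𝓘(ℝ, E) (fun s ↦ (Z s).proj) t
      ((1 : ℝ →L[ℝ] ℝ).smulRight (Z t).2) := by
  obtain ⟨hcont, hderiv⟩ := hasMFDerivAt_curve_iff.1 ((h t ht).hasMFDerivAt (hJ.mem_nhds ht))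
  have hderiv : HasDerivAt (F := E × E) _ (geodesicSpray (Z t)) t := hderiv
  exact hasMFDerivAt_curve_iff.2
    ⟨(FiberBundle.continuous_proj E _).continuousAt.comp hcont, hderiv.fst⟩

theorem velocityLift_proj_of_isMIntegralCurveOn (hJ : IsOpen J)
    (h : IsMIntegralCurveOn (I := 𝓘(ℝ, E).tangent) Z geodesicSpray J) {t : ℝ} (ht : t ∈ J) :
    velocityLift (fun s ↦ (Z s).proj) t = Z t :=
  velocityLift_eq (hasMFDerivAt_proj_of_isMIntegralCurveOn hJ h ht)

variable [FiniteDimensional ℝ E]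
  [IsContMDiffRiemannianBundle 𝓘(ℝ, E) ∞ E (fun x : M ↦ TangentSpace 𝓘(ℝ, E) x)]

theorem contMDiff_geodesicSpray :
    ContMDiff 𝓘(ℝ, E).tangent 𝓘(ℝ, E).tangent.tangent ∞
      (fun z ↦ (⟨z, geodesicSpray z⟩ :
        TangentBundle 𝓘(ℝ, E).tangent (TangentBundle 𝓘(ℝ, E) M))) := by
  intro z₀
  refine (contMDiffAt_section z₀).2 ?_
  have hchart : ContDiffAt ℝ ∞ (fun p : E × E ↦ (p.2, geodesicAcc z₀.proj p.1 p.2))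
      (extChartAt 𝓘(ℝ, E).tangent z₀ z₀) :=
    contDiffAt_snd.prodMk (contDiffAt_geodesicAcc (mem_extChartAt_target z₀.proj) _)
  refine (hchart.contMDiffAt.comp z₀
    (contMDiffAt_extChartAt (I := 𝓘(ℝ, E).tangent) (n := ∞))).congr_of_eventuallyEq ?_
  filter_upwards [extChartAt_source_mem_nhds (I := 𝓘(ℝ, E).tangent) z₀] with z hz
  rw [mem_extChartAt_tangentBundle_source] at hz
  refine (tangentCoordChange_tangentBundle hz _ _).trans (Prod.ext rfl ?_)
  exact (geodesicAcc_tangentCoordChange (mem_extChartAt_source z.proj) hz (fiberVec z)).symm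

theorem IsGeodesicOn.isMIntegralCurveOn {γ : ℝ → M} (hJ : IsOpen J)
    (h : IsGeodesicOn (E := E) γ J) :
    IsMIntegralCurveOn (I := 𝓘(ℝ, E).tangent) (velocityLift γ) geodesicSpray J := by
  intro t ht
  obtain ⟨hcont, hd, hdd, hgeod⟩ := h t ht
  let q (s : ℝ) : E := φ (γ t) (γ s)
  have hacc : deriv (deriv q) t = geodesicAcc (γ t) (q t) (deriv q t) :=
    (geodesic_equation_iff (mem_extChartAt_target (γ t)) _ _).1 hgeod
  have hlift : ∀ᶠ s in 𝓝 t, extChartAt 𝓘(ℝ, E).tangent (velocityLift (E := E) γ t)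
      (velocityLift (E := E) γ s) = (q s, deriv q s) := by
    filter_upwards [hJ.mem_nhds ht,
      hcont.eventually (extChartAt_source_mem_nhds (I := 𝓘(ℝ, E)) (γ t))] with s hsJ hs
    obtain ⟨ξ, hξ⟩ := h.hasMFDerivAt hsJ
    rw [(hasDerivAt_extChartAt_comp hs hξ).deriv, velocityLift_eq hξ]
    rfl
  have hlift_t : velocityLift γ t = ⟨γ t, deriv q t⟩ :=
    velocityLift_eq (hasMFDerivAt_curve_iff.2 ⟨hcont, hd.self_of_nhds.hasDerivAt⟩)
  apply HasMFDerivAt.hasMFDerivWithinAt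
  refine hasMFDerivAt_curve_iff.2 ⟨(FiberBundle.continuousAt_totalSpace E _).2
    ⟨hcont, hdd.continuousAt.congr (hlift.mono fun s hs ↦ (congrArg Prod.snd hs).symm)⟩, ?_⟩
  refine ((hd.self_of_nhds.hasDerivAt.prodMk hdd.hasDerivAt).congr_of_eventuallyEq
    hlift).congr_deriv ?_
  rw [hacc, hlift_t]
  rfl

theorem isGeodesicOn_proj_of_isMIntegralCurveOn (hJ : IsOpen J)
    (h : IsMIntegralCurveOn (I := 𝓘(ℝ, E).tangent) Z geodesicSpray J) :
    IsGeodesicOn (E := E) (fun t ↦ (Z t).proj) J := by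
  intro t ht
  have hproj {s : ℝ} (hs : s ∈ J) := hasMFDerivAt_proj_of_isMIntegralCurveOn hJ h hs
  have hcont := (hproj ht).continuousAt
  let q (s : ℝ) : E := φ (Z t).proj (Z s).proj
  have hq : ∀ᶠ s in 𝓝 t, HasDerivAt q
      (tangentCoordChange 𝓘(ℝ, E) (Z s).proj (Z t).proj (Z s).proj (fiberVec (Z s))) s := by
    filter_upwards [hJ.mem_nhds ht,
      hcont.eventually (extChartAt_source_mem_nhds (I := 𝓘(ℝ, E)) (Z t).proj)] with s hsJ hs
    exact hasDerivAt_extChartAt_comp hs (hproj hsJ)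
  have hderiv : HasDerivAt (F := E × E) _ (geodesicSpray (Z t)) t :=
    (hasMFDerivAt_curve_iff.1 ((h t ht).hasMFDerivAt (hJ.mem_nhds ht))).2
  have hdq : HasDerivAt (deriv q)
      (geodesicAcc (Z t).proj (φ (Z t).proj (Z t).proj) (fiberVec (Z t))) t :=
    HasDerivAt.congr_of_eventuallyEq hderiv.snd (hq.mono fun s hs ↦ hs.deriv)
  refine ⟨hcont, hq.mono fun s hs ↦ hs.differentiableAt, hdq.differentiableAt,
    (geodesic_equation_iff (mem_extChartAt_target (Z t).proj) _ _).2 ?_⟩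
  rw [hdq.deriv, hq.self_of_nhds.deriv, tangentCoordChange_self (mem_extChartAt_source _)]

end Spray

/-! ### The exponential map -/

theorem t2Space_totalSpace {B F : Type*} [TopologicalSpace B] [TopologicalSpace F] [T2Space B]
    [T2Space F] (V : B → Type*) [TopologicalSpace (TotalSpace F V)] [∀ b, TopologicalSpace (V b)]
    [FiberBundle F V] : T2Space (TotalSpace F V) := by
  refine ⟨fun z w hzw ↦ ?_⟩
  have hπ : Continuous (π F V) := FiberBundle.continuous_proj F V
  by_cases h : z.proj = w.proj
  · let e := trivializationAt F V z.proj
    have hz : z ∈ e.source := FiberBundle.mem_trivializationAt_proj_source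
    have hw : w ∈ e.source := by
      rw [e.mem_source, ← h]
      exact FiberBundle.mem_baseSet_trivializationAt' _
    have hne : e z ≠ e w := fun h' ↦ hzw (e.injOn hz hw h')
    obtain ⟨U, U', hU, hU', hzU, hwU', hd⟩ := t2_separation hne
    exact ⟨e.source ∩ e ⁻¹' U, e.source ∩ e ⁻¹' U',
      e.toOpenPartialHomeomorph.isOpen_inter_preimage hU,
      e.toOpenPartialHomeomorph.isOpen_inter_preimage hU', ⟨hz, hzU⟩, ⟨hw, hwU'⟩,
      (hd.preimage e).mono inter_subset_right inter_subset_right⟩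
  · obtain ⟨U, U', hU, hU', hzU, hwU', hd⟩ := t2_separation h
    exact ⟨_, _, hU.preimage hπ, hU'.preimage hπ, hzU, hwU', hd.preimage _⟩

theorem exists_Ioo_subset_of_Icc_subset {U : Set ℝ} (hU : IsOpen U) (h : Icc 0 1 ⊆ U) :
    ∃ ε > 0, Ioo (-ε) (1 + ε) ⊆ U := by
  obtain ⟨r, hr, hr'⟩ := isOpen_iff.1 hU 0 (h ⟨le_rfl, zero_le_one⟩)
  obtain ⟨s, hs, hs'⟩ := isOpen_iff.1 hU 1 (h ⟨zero_le_one, le_rfl⟩)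
  rw [Real.ball_eq_Ioo] at hr' hs'
  refine ⟨min r s, lt_min hr hs, fun t ⟨ht₀, ht₁⟩ ↦ ?_⟩
  have hminr := min_le_left r s
  have hmins := min_le_right r s
  rcases lt_or_ge t 0 with ht | ht
  · exact hr' ⟨by linarith, by linarith⟩
  rcases le_or_gt t 1 with ht' | ht'
  · exact h ⟨ht, ht'⟩
  · exact hs' ⟨by linarith, by linarith⟩

section Reparametrization

variable {γ : ℝ → M} {J : Set ℝ} {s t : ℝ}

theorem velocityLift_comp_mul (h : MDifferentiableAt 𝓘(ℝ, ℝ) 𝓘(ℝ, E) γ (s * t)) :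
    velocityLift (fun r ↦ γ (s * r)) t
      = ⟨γ (s * t), s • mfderiv 𝓘(ℝ, ℝ) 𝓘(ℝ, E) γ (s * t) (1 : ℝ)⟩ := by
  have hmul : HasMFDerivAt 𝓘(ℝ, ℝ) 𝓘(ℝ, ℝ) (s * ·) t ((1 : ℝ →L[ℝ] ℝ).smulRight s) := by
    have h' : HasDerivAt (s * ·) s t := by simpa using (hasDerivAt_id t).const_mul s
    exact h'.hasFDerivAt.hasMFDerivAt
  let A : ℝ →L[ℝ] E := mfderiv 𝓘(ℝ, ℝ) 𝓘(ℝ, E) γ (s * t)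
  have hA : A ∘L (1 : ℝ →L[ℝ] ℝ).smulRight s = (1 : ℝ →L[ℝ] ℝ).smulRight (s • A 1) := by
    ext
    simp [← map_smul]
  exact velocityLift_eq ((h.hasMFDerivAt.comp t hmul).congr_mfderiv hA)

variable [RiemannianBundle (fun x : M ↦ TangentSpace 𝓘(ℝ, E) x)]

theorem christoffel_smul_smul (c : M) (u v z : E) (r : ℝ) :
    christoffel c u (r • v) (r • v) z = r ^ 2 * christoffel c u v v z := by
  have hvz : (fun u' ↦ chartMetric c u' (r • v) z) = r • fun u' ↦ chartMetric c u' v z :=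
    funext fun u' ↦ chartMetric_smul_left c r u' v z
  have hvv : (fun u' ↦ chartMetric c u' (r • v) (r • v))
      = r ^ 2 • fun u' ↦ chartMetric c u' v v := by
    funext u'
    rw [chartMetric_smul_left, chartMetric_comm, chartMetric_smul_left, Pi.smul_apply, smul_eq_mul]
    ring
  have hfderiv (a : ℝ) (f : E → ℝ) : fderiv ℝ (a • f) u = a • fderiv ℝ f u :=
    congrFun (fderiv_const_smul_field (𝕜 := ℝ) (f := f) a) u
  simp only [christoffel, hvz, hvv, map_smul, hfderiv, smul_apply, smul_eq_mul]
  ring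

theorem IsGeodesicOn.comp_mul (h : IsGeodesicOn (E := E) γ J) (r : ℝ) :
    IsGeodesicOn (E := E) (fun t ↦ γ (r * t)) ((r * ·) ⁻¹' J) := by
  intro t ht
  obtain ⟨hcont, hd, hdd, hgeod⟩ := h (r * t) ht
  let q (s : ℝ) : E := φ (γ (r * t)) (γ s)
  have hmul_cont : ContinuousAt (fun t : ℝ ↦ r * t) t := by fun_prop
  have hmul (s : ℝ) : HasDerivAt (fun t : ℝ ↦ r * t) r s := by
    simpa using (hasDerivAt_id s).const_mul r
  have hq : ∀ᶠ s in 𝓝 t, HasDerivAt (fun s ↦ q (r * s)) (r • deriv q (r * s)) s := by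
    filter_upwards [hmul_cont.eventually hd] with s hs
    exact hs.hasDerivAt.scomp s (hmul s)
  have hdq : HasDerivAt (deriv fun s ↦ q (r * s)) (r • (r • deriv (deriv q) (r * t))) t :=
    HasDerivAt.congr_of_eventuallyEq ((hdd.hasDerivAt.scomp t (hmul t)).const_smul r)
      (hq.mono fun s hs ↦ hs.deriv)
  refine ⟨ContinuousAt.comp (f := fun t : ℝ ↦ r * t) hcont hmul_cont,
    hq.mono fun s hs ↦ hs.differentiableAt, hdq.differentiableAt, fun z ↦ ?_⟩
  rw [hdq.deriv, hq.self_of_nhds.deriv, christoffel_smul_smul, chartMetric_smul_left,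
    chartMetric_smul_left]
  linear_combination r ^ 2 * hgeod z

theorem isGeodesicFrom_comp_mul {a b : ℝ} (h : IsGeodesicOn (E := E) γ (Ioo a b))
    (h0 : 0 ∈ Ioo a b) {x : M} {w : TangentSpace 𝓘(ℝ, E) x} (hw : velocityLift γ 0 = ⟨x, w⟩)
    (hs : s ∈ Ioo a b) : IsGeodesicFrom x (s • w) (fun t ↦ γ (s * t)) := by
  have hsegment : Icc 0 1 ⊆ (s * ·) ⁻¹' Ioo a b := fun t ht ↦ by
    simpa [mul_comm] using (convex_Ioo a b).smul_mem_of_zero_mem h0 hs ht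
  obtain ⟨ε, hε, hsub⟩ := exists_Ioo_subset_of_Icc_subset
    (isOpen_Ioo.preimage (continuous_const_mul s)) hsegment
  refine ⟨⟨ε, hε, fun t ht ↦ h.comp_mul s t (hsub ht)⟩, ?_⟩
  obtain ⟨ξ, hξ⟩ := h.hasMFDerivAt h0
  refine (velocityLift_comp_mul (by simpa using hξ.mdifferentiableAt)).trans ?_
  rw [mul_zero]
  cases hw
  rfl

end Reparametrization

section GeodesicFlow

variable [IsManifold 𝓘(ℝ, E) ∞ M] [FiniteDimensional ℝ E]
  [RiemannianBundle (fun x : M ↦ TangentSpace 𝓘(ℝ, E) x)]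
  [IsContMDiffRiemannianBundle 𝓘(ℝ, E) ∞ E (fun x : M ↦ TangentSpace 𝓘(ℝ, E) x)]
  {γ γ' : ℝ → M} {a b a' b' s t : ℝ} {x : M} {v : TangentSpace 𝓘(ℝ, E) x}

theorem exists_isGeodesicOn (v : TangentSpace 𝓘(ℝ, E) x) :
    ∃ ε > 0, ∃ γ : ℝ → M, IsGeodesicOn (E := E) γ (Ioo (-ε) ε) ∧ velocityLift γ 0 = ⟨x, v⟩ := by
  have : CompleteSpace E := FiniteDimensional.complete ℝ E
  obtain ⟨Z, hZ0, hZ⟩ := exists_isMIntegralCurveAt_of_contMDiffAt_boundaryless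
    (I := 𝓘(ℝ, E).tangent) (v := geodesicSpray) (t₀ := 0) (x₀ := ⟨x, v⟩)
    (contMDiff_geodesicSpray.contMDiffAt.of_le (by simp))
  obtain ⟨ε, hε, h⟩ := isMIntegralCurveAt_iff'.1 hZ
  rw [Real.ball_eq_Ioo, zero_sub, zero_add] at h
  exact ⟨ε, hε, _, isGeodesicOn_proj_of_isMIntegralCurveOn isOpen_Ioo h,
    (velocityLift_proj_of_isMIntegralCurveOn isOpen_Ioo h ⟨by linarith, hε⟩).trans hZ0⟩

variable [T2Space M]

theorem IsGeodesicOn.velocityLift_eq_of_eq (h : IsGeodesicOn (E := E) γ (Ioo a b))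
    (h' : IsGeodesicOn (E := E) γ' (Ioo a' b')) (hs : s ∈ Ioo a b) (hs' : s ∈ Ioo a' b')
    (ht : t ∈ Ioo a b) (ht' : t ∈ Ioo a' b')
    (heq : velocityLift (E := E) γ s = velocityLift γ' s) :
    velocityLift (E := E) γ t = velocityLift γ' t := by
  have : T2Space (TangentBundle 𝓘(ℝ, E) M) := t2Space_totalSpace _
  exact isMIntegralCurveOn_Ioo_eq_of_eq (contMDiff_geodesicSpray.of_le (by simp))
    (h.isMIntegralCurveOn isOpen_Ioo) (h'.isMIntegralCurveOn isOpen_Ioo) hs hs' ht ht' heq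

theorem expMap_eq (h : IsGeodesicFrom x v γ) : expMap x v = γ 1 := by
  have hex : ∃ γ, IsGeodesicFrom x v γ := ⟨γ, h⟩
  rw [expMap, dif_pos hex]
  obtain ⟨⟨ε, hε, hγ⟩, h0⟩ := h
  obtain ⟨⟨ε', hε', hγ'⟩, h0'⟩ := hex.choose_spec
  exact congrArg TotalSpace.proj (hγ'.velocityLift_eq_of_eq hγ (s := 0) (t := 1)
    ⟨by linarith, by linarith⟩ ⟨by linarith, by linarith⟩ ⟨by linarith, by linarith⟩
    ⟨by linarith, by linarith⟩ (h0'.trans h0.symm))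

-- A zero of the spray is a constant integral curve, and integral curves are unique.
theorem IsGeodesicOn.fiberVec_ne_zero (h : IsGeodesicOn (E := E) γ (Ioo a b)) (hs : s ∈ Ioo a b)
    (ht : t ∈ Ioo a b) (h0 : fiberVec (velocityLift (E := E) γ s) ≠ 0) :
    fiberVec (velocityLift (E := E) γ t) ≠ 0 := by
  intro hz
  have : T2Space (TangentBundle 𝓘(ℝ, E) M) := t2Space_totalSpace _
  let z : TangentBundle 𝓘(ℝ, E) M := ⟨γ t, (0 : E)⟩
  have hzt : velocityLift (E := E) γ t = z :=
    congrArg (fun v : E ↦ (⟨γ t, v⟩ : TangentBundle 𝓘(ℝ, E) M)) hz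
  have hspray : geodesicSpray z = 0 := by
    have hacc : geodesicAcc (γ t) (φ (γ t) (γ t)) 0 = 0 := by
      rw [geodesicAcc, christoffelForm, map_zero, map_zero, smul_zero, sub_zero, map_zero,
        neg_zero]
    exact Prod.ext rfl hacc
  have hconst : IsMIntegralCurveOn (I := 𝓘(ℝ, E).tangent) (fun _ ↦ z) geodesicSpray (Ioo a b) :=
    (isMIntegralCurve_const hspray).isMIntegralCurveOn _
  exact h0 (congrArg fiberVec (isMIntegralCurveOn_Ioo_eq_of_eq
    (contMDiff_geodesicSpray.of_le (by simp)) (h.isMIntegralCurveOn isOpen_Ioo) hconst ht ht hs hs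
    hzt))

/-- `Φ` is, near `z₀`, the time-1-map of the geodesic flow. -/
def IsGeodesicFlowAt (Φ : TangentBundle 𝓘(ℝ, E) M → TangentBundle 𝓘(ℝ, E) M)
    (z₀ : TangentBundle 𝓘(ℝ, E) M) : Prop :=
  ∀ᶠ z in 𝓝 z₀, z.2 ∈ expDomain z.proj ∧
    ∀ γ : ℝ → M, IsGeodesicFrom z.proj z.2 γ → velocityLift γ 1 = Φ z

theorem exists_isGeodesicFlowAt (hv : v ∈ expDomain x) :
    ∃ Φ, IsGeodesicFlowAt Φ ⟨x, v⟩ ∧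
      MDifferentiableAt 𝓘(ℝ, E).tangent 𝓘(ℝ, E).tangent Φ ⟨x, v⟩ := by
  have : T2Space (TangentBundle 𝓘(ℝ, E) M) := t2Space_totalSpace _
  have : CompleteSpace E := FiniteDimensional.complete ℝ E
  obtain ⟨γ, ⟨ε, hε, hγ⟩, hγ0⟩ := hv
  have hγ0 : velocityLift γ 0 = (⟨x, v⟩ : TangentBundle 𝓘(ℝ, E) M) := hγ0
  obtain ⟨Φ, hΦ⟩ := exists_isFlowMapAt_of_isMIntegralCurveOn (s := 0) (t := 1)
    (contMDiff_geodesicSpray.of_le (WithTop.coe_le_coe.2 le_top))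
    (hγ.isMIntegralCurveOn isOpen_Ioo) (by linarith) zero_le_one (by linarith)
  rw [hγ0] at hΦ
  refine ⟨Φ, ?_, hΦ.1⟩
  filter_upwards [hΦ.2, hΦ.eventually_apply_eq (contMDiff_geodesicSpray.of_le (by simp))
    zero_le_one] with z ⟨δ, hδ, σ, hσ, hσ0, hσ1⟩ hz
  rw [zero_sub] at hσ
  refine ⟨⟨fun t ↦ (σ t).proj, ⟨δ, hδ, isGeodesicOn_proj_of_isMIntegralCurveOn isOpen_Ioo hσ⟩,
    (velocityLift_proj_of_isMIntegralCurveOn isOpen_Ioo hσ ⟨by linarith, by linarith⟩).trans hσ0⟩,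
    ?_⟩
  rintro γ ⟨⟨δ, hδ, hγ⟩, hγ0⟩
  exact hz (velocityLift γ) _ _ (hγ.isMIntegralCurveOn isOpen_Ioo) (by linarith) (by linarith) hγ0

end GeodesicFlow

section BundleMaps

theorem hasMFDerivAt_of_eventually_extChartAt_eq {𝕜 V V' H H' N N' : Type*}
    [NontriviallyNormedField 𝕜] [NormedAddCommGroup V] [NormedSpace 𝕜 V] [NormedAddCommGroup V']
    [NormedSpace 𝕜 V'] [TopologicalSpace H] [TopologicalSpace H'] {I : ModelWithCorners 𝕜 V H}
    {I' : ModelWithCorners 𝕜 V' H'} [I.Boundaryless] [I'.Boundaryless] [TopologicalSpace N]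
    [ChartedSpace H N] [TopologicalSpace N'] [ChartedSpace H' N'] {f : N → N'} {x : N}
    {g : V → V'} {g' : V →L[𝕜] V'} (hg : HasFDerivAt g g' (extChartAt I x x))
    (hfg : ∀ᶠ z in 𝓝 x, f z ∈ (extChartAt I' (f x)).source ∧
      extChartAt I' (f x) (f z) = g (extChartAt I x z)) : HasMFDerivAt I I' f x g' := by
  constructor
  · have hsymm : ContinuousAt (extChartAt I' (f x)).symm (g (extChartAt I x x)) :=
      hfg.self_of_nhds.2 ▸ continuousAt_extChartAt_symm (f x)
    refine ((hsymm.comp hg.continuousAt).comp (continuousAt_extChartAt x)).congr ?_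
    filter_upwards [hfg] with z hz
    rw [Function.comp_apply, Function.comp_apply, ← hz.2, (extChartAt I' (f x)).left_inv hz.1]
  · refine HasFDerivAt.hasFDerivWithinAt (hg.congr_of_eventuallyEq ?_)
    rw [EventuallyEq, ← map_extChartAt_nhds_of_boundaryless, eventually_map]
    filter_upwards [hfg, extChartAt_source_mem_nhds (I := I) x] with z hz hzx
    rw [writtenInExtChartAt, Function.comp_apply, Function.comp_apply,
      (extChartAt I x).left_inv hzx, hz.2]

theorem hasMFDerivAt_totalSpace_proj {F : Type*} [NormedAddCommGroup F] [NormedSpace ℝ F]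
    (V : M → Type*) [TopologicalSpace (TotalSpace F V)] [∀ x, TopologicalSpace (V x)]
    [FiberBundle F V] (z : TotalSpace F V) :
    HasMFDerivAt (𝓘(ℝ, E).prod 𝓘(ℝ, F)) 𝓘(ℝ, E) (π F V) z (ContinuousLinearMap.fst ℝ E F) := by
  refine hasMFDerivAt_of_eventually_extChartAt_eq hasFDerivAt_fst ?_
  filter_upwards [(FiberBundle.continuous_proj F V).continuousAt.eventually
      (extChartAt_source_mem_nhds (I := 𝓘(ℝ, E)) z.proj),
    extChartAt_source_mem_nhds (I := 𝓘(ℝ, E).prod 𝓘(ℝ, F)) z] with ζ hζ hζz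
  rw [FiberBundle.extChartAt] at hζz ⊢
  exact ⟨hζ, congrArg (φ z.proj) ((trivializationAt F V z.proj).coe_fst hζz.1).symm⟩

variable [IsManifold 𝓘(ℝ, E) ∞ M] [RiemannianBundle (fun x : M ↦ TangentSpace 𝓘(ℝ, E) x)]
  {x : M}

theorem hasMFDerivAt_tangentBundle_mk (v : TangentSpace 𝓘(ℝ, E) x) :
    HasMFDerivAt 𝓘(ℝ, TangentSpace 𝓘(ℝ, E) x) 𝓘(ℝ, E).tangent
      (fun w ↦ (⟨x, w⟩ : TangentBundle 𝓘(ℝ, E) M)) v (ContinuousLinearMap.inr ℝ E E) := by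
  refine ⟨(FiberBundle.continuous_totalSpaceMk E (TangentSpace 𝓘(ℝ, E)) x).continuousAt, ?_⟩
  have h : HasFDerivAt (fun w : E ↦ (φ x x, w)) (ContinuousLinearMap.inr ℝ E E) v :=
    hasFDerivAt_prodMk_right _ _
  refine HasFDerivAt.hasFDerivWithinAt (s := range id) (h.congr_of_eventuallyEq ?_)
  refine Eventually.of_forall fun w ↦ Prod.ext rfl ?_
  exact tangentCoordChange_self (mem_extChartAt_source x)

end BundleMaps

section ExpMap

variable [IsManifold 𝓘(ℝ, E) ∞ M] [FiniteDimensional ℝ E]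
  [RiemannianBundle (fun x : M ↦ TangentSpace 𝓘(ℝ, E) x)]
  [IsContMDiffRiemannianBundle 𝓘(ℝ, E) ∞ E (fun x : M ↦ TangentSpace 𝓘(ℝ, E) x)]
  {γ : ℝ → M} {a b s : ℝ} {x : M} {v w : TangentSpace 𝓘(ℝ, E) x}

theorem exists_isGeodesicOn_smul_eq [Nontrivial E] (hv : v ∈ expDomain x) :
    ∃ (γ : ℝ → M) (a b s : ℝ) (w : TangentSpace 𝓘(ℝ, E) x), IsGeodesicOn (E := E) γ (Ioo a b) ∧
      0 ∈ Ioo a b ∧ s ∈ Ioo a b ∧ velocityLift γ 0 = ⟨x, w⟩ ∧ w ≠ 0 ∧ s • w = v := by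
  by_cases hv0 : v = 0
  · obtain ⟨w, hw⟩ : ∃ w : TangentSpace 𝓘(ℝ, E) x, w ≠ 0 := exists_ne (0 : E)
    obtain ⟨ε, hε, γ, hγ, hγ0⟩ := exists_isGeodesicOn w
    have h0 : (0 : ℝ) ∈ Ioo (-ε) ε := ⟨by linarith, hε⟩
    exact ⟨γ, -ε, ε, 0, w, hγ, h0, h0, hγ0, hw, by rw [zero_smul, hv0]⟩
  · obtain ⟨γ, ⟨ε, hε, hγ⟩, hγ0⟩ := hv
    exact ⟨γ, -ε, 1 + ε, 1, v, hγ, ⟨by linarith, by linarith⟩, ⟨by linarith, by linarith⟩, hγ0,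
      hv0, one_smul ℝ v⟩

variable [T2Space M]

theorem IsGeodesicFlowAt.eventually_expMap_eq
    {Φ : TangentBundle 𝓘(ℝ, E) M → TangentBundle 𝓘(ℝ, E) M} {z₀ : TangentBundle 𝓘(ℝ, E) M}
    (hΦ : IsGeodesicFlowAt Φ z₀) : ∀ᶠ z in 𝓝 z₀, expMap z.proj z.2 = (Φ z).proj := by
  filter_upwards [hΦ] with z ⟨⟨γ, hγ⟩, h⟩
  rw [← h γ hγ]
  exact expMap_eq hγ

theorem IsGeodesicFlowAt.hasMFDerivAt_expMap
    {Φ : TangentBundle 𝓘(ℝ, E) M → TangentBundle 𝓘(ℝ, E) M} (hΦ : IsGeodesicFlowAt Φ ⟨x, v⟩)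
    {L : E × E →L[ℝ] E × E}
    (hL : HasMFDerivAt 𝓘(ℝ, E).tangent 𝓘(ℝ, E).tangent Φ (⟨x, v⟩ : TangentBundle 𝓘(ℝ, E) M) L) :
    HasMFDerivAt 𝓘(ℝ, TangentSpace 𝓘(ℝ, E) x) 𝓘(ℝ, E) (expMap x) v
      (ContinuousLinearMap.fst ℝ E E ∘L L ∘L ContinuousLinearMap.inr ℝ E E) := by
  have hmk := hasMFDerivAt_tangentBundle_mk v
  exact ((hasMFDerivAt_totalSpace_proj _ _).comp v (hL.comp v hmk)).congr_of_eventuallyEq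
    (hmk.continuousAt.eventually hΦ.eventually_expMap_eq)

theorem mdifferentiableAt_expMap (hv : v ∈ expDomain x) :
    MDifferentiableAt 𝓘(ℝ, TangentSpace 𝓘(ℝ, E) x) 𝓘(ℝ, E) (expMap x) v := by
  obtain ⟨Φ, hΦ, hd⟩ := exists_isGeodesicFlowAt hv
  exact (hΦ.hasMFDerivAt_expMap hd.hasMFDerivAt).mdifferentiableAt

theorem expMap_smul (hγ : IsGeodesicOn (E := E) γ (Ioo a b)) (h0 : 0 ∈ Ioo a b)
    (hw : velocityLift γ 0 = ⟨x, w⟩) (hs : s ∈ Ioo a b) : expMap x (s • w) = γ s := by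
  rw [expMap_eq (isGeodesicFrom_comp_mul hγ h0 hw hs), mul_one]

-- `d(exp x) (s • w) w` is the velocity at time `s` of the geodesic with initial velocity `w`.
theorem mfderiv_expMap_smul_ne_zero (hγ : IsGeodesicOn (E := E) γ (Ioo a b)) (h0 : 0 ∈ Ioo a b)
    (hw : velocityLift γ 0 = ⟨x, w⟩) (hw0 : w ≠ 0) (hs : s ∈ Ioo a b) :
    mfderiv 𝓘(ℝ, TangentSpace 𝓘(ℝ, E) x) 𝓘(ℝ, E) (expMap x) (s • w) w ≠ 0 := by
  intro hzero
  have hline : HasMFDerivAt 𝓘(ℝ, ℝ) 𝓘(ℝ, TangentSpace 𝓘(ℝ, E) x) (fun r : ℝ ↦ r • w) s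
      ((1 : ℝ →L[ℝ] ℝ).smulRight w) :=
    ((1 : ℝ →L[ℝ] ℝ).smulRight w).hasMFDerivAt
  have hexp := mdifferentiableAt_expMap ⟨_, isGeodesicFrom_comp_mul hγ h0 hw hs⟩
  have hcurve : γ =ᶠ[𝓝 s] expMap x ∘ fun r ↦ r • w :=
    eventually_of_mem (isOpen_Ioo.mem_nhds hs) fun r hr ↦ (expMap_smul hγ h0 hw hr).symm
  have hvel := (hexp.hasMFDerivAt.comp s hline).congr_of_eventuallyEq hcurve
  refine hγ.fiberVec_ne_zero h0 hs (by rw [hw]; exact hw0) ?_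
  refine (congrArg (fun L : ℝ →L[ℝ] E ↦ L 1) hvel.mfderiv).trans ?_
  exact (congrArg _ (one_smul ℝ w)).trans hzero

theorem finrank_expKer_lt [Nontrivial E] (hv : v ∈ expDomain x) :
    finrank ℝ (expKer x v) < finrank ℝ E := by
  obtain ⟨γ, a, b, s, w, hγ, h0, hs, hw, hw0, rfl⟩ := exists_isGeodesicOn_smul_eq hv
  have : FiniteDimensional ℝ (TangentSpace 𝓘(ℝ, E) x) := inferInstanceAs (FiniteDimensional ℝ E)
  refine Submodule.finrank_lt fun htop ↦ mfderiv_expMap_smul_ne_zero hγ h0 hw hw0 hs ?_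
  exact Submodule.eq_top_iff'.1 htop w

end ExpMap

theorem IsConjugateAlong.nontrivial [RiemannianBundle (fun x : M ↦ TangentSpace 𝓘(ℝ, E) x)]
    {x : M} {v : TangentSpace 𝓘(ℝ, E) x} (h : IsConjugateAlong x v) : Nontrivial E := by
  obtain ⟨w, -, hw⟩ := Submodule.exists_mem_ne_zero_of_ne_bot h.2
  exact ⟨⟨w, 0, hw⟩⟩

/-! ### The Hamiltonian flow -/

section Symplectic

theorem eq_of_forall_stdSymplectic_eq {ξ ξ' : E × (E →L[ℝ] ℝ)}
    (h : ∀ η, stdSymplectic ξ η = stdSymplectic ξ' η) : ξ = ξ' := by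
  refine Prod.ext ((SeparatingDual.eq_iff_forall_dual_eq (R := ℝ)).2 fun ℓ ↦ ?_)
    (ContinuousLinearMap.ext fun z ↦ ?_)
  · simpa only [stdSymplectic, map_zero, sub_zero] using h (0, ℓ)
  · simpa only [stdSymplectic, zero_apply, zero_sub, neg_inj] using h (z, 0)

end Symplectic

section CotangentBundleCharts

/-- The covector of an element of the cotangent bundle, in the chart at its base point. -/
def covec (α : CotangentBundle E M) : E →L[ℝ] ℝ := α.2

variable [IsManifold 𝓘(ℝ, E) ∞ M] {α α₀ : CotangentBundle E M}

theorem canonicalCoords_eq (h : α.proj ∈ (φ c).source) :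
    canonicalCoords c α =
      (φ c α.proj, covec α ∘L tangentCoordChange 𝓘(ℝ, E) c α.proj α.proj) :=
  Prod.ext rfl (congrArg (fun D : E →L[ℝ] E ↦ covec α ∘L D) (mfderiv_extChartAt_symm_apply h))

theorem mem_extChartAt_cotangentBundle_source :
    α ∈ (extChartAt (cotangentModel E) α₀).source ↔ α.proj ∈ (φ α₀.proj).source := by
  rw [extChartAt_source, extChartAt_source, FiberBundle.chartedSpace_chartAt]
  simp only [mfld_simps]
  exact ⟨fun h ↦ h.1.1, fun h ↦ ⟨⟨h, mem_univ _⟩, h⟩⟩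

theorem extChartAt_cotangentBundle (h : α.proj ∈ (φ α₀.proj).source) :
    extChartAt (cotangentModel E) α₀ α = canonicalCoords α₀.proj α := by
  rw [canonicalCoords_eq h]
  refine Prod.ext rfl ?_
  have hsnd : (extChartAt (cotangentModel E) α₀ α).2 =
      ContinuousLinearMap.inCoordinates E (TangentSpace 𝓘(ℝ, E)) ℝ (Trivial M ℝ)
        α₀.proj α.proj α₀.proj α.proj α.2 := rfl
  rw [extChartAt_source] at h
  rw [hsnd, ContinuousLinearMap.inCoordinates, TangentBundle.symmL_trivializationAt_eq_core h]
  simp only [Trivial.fiberBundle_trivializationAt', Trivial.continuousLinearMapAt_trivialization]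
  rfl

theorem eventually_extChartAt_cotangentBundle (α : CotangentBundle E M) :
    ∀ᶠ β in 𝓝 α, β.proj ∈ (φ α.proj).source ∧
      extChartAt (cotangentModel E) α β = canonicalCoords α.proj β := by
  filter_upwards [extChartAt_source_mem_nhds (I := cotangentModel E) α] with β hβ
  rw [mem_extChartAt_cotangentBundle_source] at hβ
  exact ⟨hβ, extChartAt_cotangentBundle hβ⟩

theorem hasMFDerivAt_canonicalCoords (α : CotangentBundle E M) :
    HasMFDerivAt (cotangentModel E) 𝓘(ℝ, E × (E →L[ℝ] ℝ)) (canonicalCoords α.proj) α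
      (ContinuousLinearMap.id ℝ (E × (E →L[ℝ] ℝ))) := by
  have h := (mdifferentiableAt_extChartAt (I := cotangentModel E)
    (mem_chart_source _ α)).hasMFDerivAt
  rw [mfderiv_extChartAt_self] at h
  exact h.congr_of_eventuallyEq
    ((eventually_extChartAt_cotangentBundle α).mono fun β hβ ↦ hβ.2.symm)

theorem cotangentSymplectic_eq (α : CotangentBundle E M) (ξ η : E × (E →L[ℝ] ℝ)) :
    cotangentSymplectic α ξ η = stdSymplectic ξ η :=
  congrArg (fun D : E × (E →L[ℝ] ℝ) →L[ℝ] E × (E →L[ℝ] ℝ) ↦ stdSymplectic (D ξ) (D η))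
    (hasMFDerivAt_canonicalCoords α).mfderiv

end CotangentBundleCharts

section HamiltonianField

variable [RiemannianBundle (fun x : M ↦ TangentSpace 𝓘(ℝ, E) x)]

local instance : NormedAddCommGroup (E →L[ℝ] E →L[ℝ] ℝ) :=
  ContinuousLinearMap.toNormedAddCommGroup

local instance : NormedSpace ℝ (E →L[ℝ] E →L[ℝ] ℝ) := ContinuousLinearMap.toNormedSpace

/-- The Hamiltonian vector field of the geodesic Hamiltonian, in the canonical coordinates
`p = (x, y)` given by the chart at `c`. -/
def chartHamiltonianField (c : M) (p : E × (E →L[ℝ] ℝ)) : E × (E →L[ℝ] ℝ) :=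
  letI w := chartSharp c p.1 p.2
  (w, fderiv ℝ (chartMetricL c) p.1 w w - christoffelForm c p.1 w)

theorem stdSymplectic_chartHamiltonianField (c : M) (p η : E × (E →L[ℝ] ℝ)) :
    letI w := chartSharp c p.1 p.2
    stdSymplectic (chartHamiltonianField c p) η =
      η.2 w - 1 / 2 * fderiv ℝ (chartMetricL c) p.1 η.1 w w := by
  simp only [stdSymplectic, chartHamiltonianField, sub_apply, christoffelForm_eq]
  ring

variable [FiniteDimensional ℝ E]

/-- The vector that the metric associates with a covector, in the chart at the base point. -/
def sharpVec (α : CotangentBundle E M) : E :=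
  letI y : TangentSpace 𝓘(ℝ, E) α.proj →L[ℝ] ℝ := α.2
  haveI : FiniteDimensional ℝ (TangentSpace 𝓘(ℝ, E) α.proj) :=
    inferInstanceAs (FiniteDimensional ℝ E)
  haveI : CompleteSpace (TangentSpace 𝓘(ℝ, E) α.proj) := FiniteDimensional.complete ℝ _
  (InnerProductSpace.toDual ℝ (TangentSpace 𝓘(ℝ, E) α.proj)).symm y

theorem innerAt_sharpVec (α : CotangentBundle E M) (v : E) :
    innerAt α.proj (sharpVec α) v = covec α v :=
  haveI : FiniteDimensional ℝ (TangentSpace 𝓘(ℝ, E) α.proj) :=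
    inferInstanceAs (FiniteDimensional ℝ E)
  haveI : CompleteSpace (TangentSpace 𝓘(ℝ, E) α.proj) := FiniteDimensional.complete ℝ _
  InnerProductSpace.toDual_symm_apply (𝕜 := ℝ) (E := TangentSpace 𝓘(ℝ, E) α.proj)

theorem geodesicHamiltonian_eq (α : CotangentBundle E M) :
    geodesicHamiltonian α = covec α (sharpVec α) / 2 := rfl

variable [IsManifold 𝓘(ℝ, E) ∞ M] {α : CotangentBundle E M}

theorem chartSharp_canonicalCoords (h : α.proj ∈ (φ c).source) :
    chartSharp c (canonicalCoords c α).1 (canonicalCoords c α).2 =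
      tangentCoordChange 𝓘(ℝ, E) α.proj c α.proj (sharpVec α) := by
  have hs := mem_extChartAt_source (I := 𝓘(ℝ, E)) α.proj
  have hcovec : covec α ∘L tangentCoordChange 𝓘(ℝ, E) c α.proj α.proj =
      chartMetricL c (φ c α.proj) (tangentCoordChange 𝓘(ℝ, E) α.proj c α.proj (sharpVec α)) := by
    ext z
    rw [chartMetricL_apply, chartMetric_eq_innerAt h,
      tangentCoordChange_tangentCoordChange_cancel hs h, innerAt_sharpVec,
      ContinuousLinearMap.comp_apply]
  rw [canonicalCoords_eq h, hcovec, chartSharp_chartMetricL ((φ c).map_source h)]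

theorem chartSharp_canonicalCoords_self (α : CotangentBundle E M) :
    chartSharp α.proj (canonicalCoords α.proj α).1 (canonicalCoords α.proj α).2 = sharpVec α := by
  have hs := mem_extChartAt_source (I := 𝓘(ℝ, E)) α.proj
  rw [chartSharp_canonicalCoords hs, tangentCoordChange_self hs]

theorem geodesicHamiltonian_eq_chartSharp (h : α.proj ∈ (φ c).source) :
    letI p := canonicalCoords c α
    geodesicHamiltonian α = p.2 (chartSharp c p.1 p.2) / 2 := by
  rw [chartSharp_canonicalCoords h, canonicalCoords_eq h, ContinuousLinearMap.comp_apply,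
    tangentCoordChange_tangentCoordChange_cancel (mem_extChartAt_source α.proj) h,
    geodesicHamiltonian_eq]

/-- The musical isomorphism `T*M → TM` of the metric, as a map between total spaces. -/
def sharpLift (α : CotangentBundle E M) : TangentBundle 𝓘(ℝ, E) M :=
  ⟨α.proj, sharpVec (E := E) α⟩

theorem extChartAt_sharpLift {α₀ : CotangentBundle E M} (h : α.proj ∈ (φ α₀.proj).source) :
    letI p := extChartAt (cotangentModel E) α₀ α
    extChartAt 𝓘(ℝ, E).tangent (sharpLift α₀) (sharpLift α) =
      (p.1, chartSharp α₀.proj p.1 p.2) := by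
  rw [extChartAt_cotangentBundle h, chartSharp_canonicalCoords h]
  rfl

variable [IsContMDiffRiemannianBundle 𝓘(ℝ, E) ∞ E (fun x : M ↦ TangentSpace 𝓘(ℝ, E) x)]
  {p : E × (E →L[ℝ] ℝ)}

theorem exists_hasFDerivAt_chartSharp (hu : p.1 ∈ (φ c).target) :
    ∃ S : E × (E →L[ℝ] ℝ) →L[ℝ] E, HasFDerivAt (fun p ↦ chartSharp c p.1 p.2) S p ∧
      ∀ η, fderiv ℝ (chartMetricL c) p.1 η.1 (chartSharp c p.1 p.2) + chartMetricL c p.1 (S η) =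
        η.2 := by
  have hsharp : HasFDerivAt (fun p : E × (E →L[ℝ] ℝ) ↦ chartSharp c p.1) _ p :=
    HasFDerivAt.comp (g := chartSharp c) (f := Prod.fst) p
      ((contDiffAt_chartSharp hu).differentiableAt (by simp)).hasFDerivAt hasFDerivAt_fst
  have hS := hsharp.clm_apply hasFDerivAt_snd
  refine ⟨_, hS, fun η ↦ ?_⟩
  have hmetric : HasFDerivAt (fun p : E × (E →L[ℝ] ℝ) ↦ chartMetricL c p.1) _ p :=
    HasFDerivAt.comp (g := chartMetricL c) (f := Prod.fst) p (hasFDerivAt_chartMetricL hu)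
      hasFDerivAt_fst
  have hinv : HasFDerivAt (fun p : E × (E →L[ℝ] ℝ) ↦ chartMetricL c p.1 (chartSharp c p.1 p.2))
      (ContinuousLinearMap.snd ℝ E (E →L[ℝ] ℝ)) p := by
    refine hasFDerivAt_snd.congr_of_eventuallyEq ?_
    filter_upwards [continuousAt_fst.eventually ((isOpen_extChartAt_target c).mem_nhds hu)]
      with p hp using chartMetricL_chartSharp hp p.2
  have happly := congrArg (fun L : E × (E →L[ℝ] ℝ) →L[ℝ] (E →L[ℝ] ℝ) ↦ L η)
    ((hmetric.clm_apply hS).unique hinv)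
  rw [add_comm]
  exact happly

theorem exists_hasFDerivAt_chartHamiltonian (hu : p.1 ∈ (φ c).target) :
    ∃ A : E × (E →L[ℝ] ℝ) →L[ℝ] ℝ,
      HasFDerivAt (fun p : E × (E →L[ℝ] ℝ) ↦ p.2 (chartSharp c p.1 p.2) / 2) A p ∧
        ∀ η, A η = stdSymplectic (chartHamiltonianField c p) η := by
  obtain ⟨S, hS, hS_apply⟩ := exists_hasFDerivAt_chartSharp hu
  have hA : HasFDerivAt (fun p : E × (E →L[ℝ] ℝ) ↦ p.2 (chartSharp c p.1 p.2) / 2) _ p :=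
    ((hasFDerivAt_snd.clm_apply hS).const_mul (2⁻¹ : ℝ)).congr_of_eventuallyEq
      (Eventually.of_forall fun p ↦ by ring)
  refine ⟨_, hA, fun η ↦ ?_⟩
  have hη := congrArg (fun ℓ : E →L[ℝ] ℝ ↦ ℓ (chartSharp c p.1 p.2)) (hS_apply η)
  have hsymm : p.2 (S η) = chartMetricL c p.1 (S η) (chartSharp c p.1 p.2) := by
    conv_lhs => rw [← chartMetricL_chartSharp hu p.2]
    exact chartMetric_comm _ _ _ _
  simp only [add_apply] at hη
  simp only [stdSymplectic_chartHamiltonianField, smul_apply, add_apply,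
    ContinuousLinearMap.comp_apply, ContinuousLinearMap.flip_apply, ContinuousLinearMap.coe_snd',
    smul_eq_mul, hsymm]
  linarith

theorem mfderiv_geodesicHamiltonian (α : CotangentBundle E M) (η : E × (E →L[ℝ] ℝ)) :
    mfderiv (cotangentModel E) 𝓘(ℝ, ℝ) geodesicHamiltonian α η =
      stdSymplectic (chartHamiltonianField α.proj (canonicalCoords α.proj α)) η := by
  obtain ⟨A, hA, hA_apply⟩ := exists_hasFDerivAt_chartHamiltonian (c := α.proj)
    (p := canonicalCoords α.proj α) (mem_extChartAt_target α.proj)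
  have hH : HasMFDerivAt (cotangentModel E) 𝓘(ℝ, ℝ) geodesicHamiltonian α A := by
    refine (hA.hasMFDerivAt.comp α (hasMFDerivAt_canonicalCoords α)).congr_of_eventuallyEq ?_
    filter_upwards [eventually_extChartAt_cotangentBundle α] with β hβ
      using geodesicHamiltonian_eq_chartSharp hβ.1
  rw [← hA_apply, hH.mfderiv]
  rfl

theorem hasDerivAt_chartSharp_comp {P : ℝ → E × (E →L[ℝ] ℝ)} {t : ℝ}
    (hu : (P t).1 ∈ (φ c).target) (hP : HasDerivAt P (chartHamiltonianField c (P t)) t) :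
    HasDerivAt (fun s ↦ chartSharp c (P s).1 (P s).2)
      (geodesicAcc c (P t).1 (chartSharp c (P t).1 (P t).2)) t := by
  obtain ⟨S, hS, hS_apply⟩ := exists_hasFDerivAt_chartSharp hu
  have hacc : S (chartHamiltonianField c (P t)) =
      geodesicAcc c (P t).1 (chartSharp c (P t).1 (P t).2) := by
    have h := hS_apply (chartHamiltonianField c (P t))
    rw [chartHamiltonianField, sub_eq_add_neg, add_right_inj] at h
    rw [geodesicAcc, ← map_neg, ← h, chartSharp_chartMetricL hu]
    rfl
  exact hacc ▸ hS.comp_hasDerivAt t hP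

theorem exists_hasMFDerivAt_sharpLift (α : CotangentBundle E M) :
    ∃ S : E × (E →L[ℝ] ℝ) →L[ℝ] E × E,
      HasMFDerivAt (cotangentModel E) 𝓘(ℝ, E).tangent sharpLift α S ∧
        (∀ ζ, (S ζ).1 = ζ.1) ∧ Function.Injective S := by
  have hα : extChartAt (cotangentModel E) α α = canonicalCoords α.proj α :=
    extChartAt_cotangentBundle (mem_extChartAt_source α.proj)
  obtain ⟨S, hS, hS_apply⟩ := exists_hasFDerivAt_chartSharp (c := α.proj)
    (p := extChartAt (cotangentModel E) α α) (hα ▸ mem_extChartAt_target α.proj)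
  refine ⟨(ContinuousLinearMap.fst ℝ E (E →L[ℝ] ℝ)).prod S,
    hasMFDerivAt_of_eventually_extChartAt_eq (hasFDerivAt_fst.prodMk hS) ?_, fun ζ ↦ rfl,
    (injective_iff_map_eq_zero _).2 fun ζ hζ ↦ ?_⟩
  · filter_upwards [extChartAt_source_mem_nhds (I := cotangentModel E) α] with β hβ
    rw [mem_extChartAt_cotangentBundle_source] at hβ
    exact ⟨mem_extChartAt_tangentBundle_source.2 hβ, extChartAt_sharpLift hβ⟩
  · obtain ⟨hζ₁, hζ₂⟩ : ζ.1 = 0 ∧ S ζ = 0 := Prod.mk_eq_zero.1 hζ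
    have hζ_apply := hS_apply ζ
    rw [hζ₁, hζ₂, map_zero, map_zero, zero_apply, add_zero] at hζ_apply
    exact Prod.ext hζ₁ hζ_apply.symm

end HamiltonianField

section HamiltonianMotion

variable [IsManifold 𝓘(ℝ, E) ∞ M] [FiniteDimensional ℝ E]
  [RiemannianBundle (fun x : M ↦ TangentSpace 𝓘(ℝ, E) x)]
  [IsContMDiffRiemannianBundle 𝓘(ℝ, E) ∞ E (fun x : M ↦ TangentSpace 𝓘(ℝ, E) x)]
  {a : ℝ → CotangentBundle E M} {J : Set ℝ} {t : ℝ}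

theorem IsHamiltonianMotionOn.hasDerivAt (h : IsHamiltonianMotionOn a J) (ht : t ∈ J) :
    ContinuousAt a t ∧ HasDerivAt (fun s ↦ canonicalCoords (a t).proj (a s))
      (chartHamiltonianField (a t).proj (canonicalCoords (a t).proj (a t))) t := by
  obtain ⟨ξ, hξ, hω⟩ := h t ht
  obtain ⟨hcont, hderiv⟩ := hasMFDerivAt_curve_iff.1 hξ
  have hfield : ξ = chartHamiltonianField (a t).proj (canonicalCoords (a t).proj (a t)) :=
    eq_of_forall_stdSymplectic_eq fun η ↦ (cotangentSymplectic_eq (a t) ξ η).symm.trans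
      ((hω η).trans (mfderiv_geodesicHamiltonian (a t) η))
  have hderiv : HasDerivAt (F := E × (E →L[ℝ] ℝ)) _ ξ t := hderiv
  rw [← hfield]
  refine ⟨hcont, hderiv.congr_of_eventuallyEq ?_⟩
  filter_upwards [hcont.eventually (eventually_extChartAt_cotangentBundle (a t))] with s hs
    using hs.2.symm

theorem IsHamiltonianMotionOn.hasMFDerivAt_proj (h : IsHamiltonianMotionOn a J) (ht : t ∈ J) :
    HasMFDerivAt 𝓘(ℝ, ℝ) 𝓘(ℝ, E) (fun s ↦ (a s).proj) t
      ((1 : ℝ →L[ℝ] ℝ).smulRight (sharpVec (E := E) (a t) : TangentSpace 𝓘(ℝ, E) (a t).proj)) := by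
  obtain ⟨hcont, hderiv⟩ := h.hasDerivAt ht
  have hvel : HasDerivAt (fun s ↦ φ (a t).proj (a s).proj)
      (chartHamiltonianField (a t).proj (canonicalCoords (a t).proj (a t))).1 t :=
    HasFDerivAt.comp_hasDerivAt (l := Prod.fst) (f := fun s ↦ canonicalCoords (a t).proj (a s)) t
      hasFDerivAt_fst hderiv
  rw [chartHamiltonianField, chartSharp_canonicalCoords_self] at hvel
  exact hasMFDerivAt_curve_iff.2
    ⟨(FiberBundle.continuous_proj (E →L[ℝ] ℝ) _).continuousAt.comp hcont, hvel⟩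

theorem IsHamiltonianMotionOn.isGeodesicOn (h : IsHamiltonianMotionOn a J) (hJ : IsOpen J) :
    IsGeodesicOn (E := E) (fun t ↦ (a t).proj) J := by
  intro t ht
  obtain ⟨hcont, hderiv⟩ := h.hasDerivAt ht
  let P (s : ℝ) : E × (E →L[ℝ] ℝ) := canonicalCoords (a t).proj (a s)
  have hu : (P t).1 ∈ (φ (a t).proj).target := mem_extChartAt_target (a t).proj
  have hvel : ∀ᶠ s in 𝓝 t, HasDerivAt (fun r ↦ φ (a t).proj (a r).proj)
      (chartSharp (a t).proj (P s).1 (P s).2) s := by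
    filter_upwards [hJ.mem_nhds ht, hcont.eventually (eventually_extChartAt_cotangentBundle (a t))]
      with s hsJ hs
    rw [chartSharp_canonicalCoords hs.1]
    exact hasDerivAt_extChartAt_comp hs.1 (h.hasMFDerivAt_proj hsJ)
  have hacc : HasDerivAt (deriv fun r ↦ φ (a t).proj (a r).proj)
      (geodesicAcc (a t).proj (P t).1 (chartSharp (a t).proj (P t).1 (P t).2)) t :=
    (hasDerivAt_chartSharp_comp hu hderiv).congr_of_eventuallyEq (hvel.mono fun s hs ↦ hs.deriv)
  refine ⟨(h.hasMFDerivAt_proj ht).continuousAt, hvel.mono fun s hs ↦ hs.differentiableAt,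
    hacc.differentiableAt, (geodesic_equation_iff hu _ _).2 ?_⟩
  rw [hacc.deriv, hvel.self_of_nhds.deriv]

theorem exists_isGeodesicFrom_of_mem_flowGraph {p : CotangentBundle E M × CotangentBundle E M}
    (hp : p ∈ flowGraph E M) :
    ∃ γ, IsGeodesicFrom (E := E) p.1.proj (sharpVec (E := E) p.1) γ ∧
      velocityLift γ 1 = sharpLift p.2 := by
  obtain ⟨α, β⟩ := p
  obtain ⟨ε, hε, a, ha, rfl, rfl⟩ := hp
  have hvel (t : ℝ) (ht : t ∈ Ioo (-ε) (1 + ε)) :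
      velocityLift (fun s ↦ (a s).proj) t = sharpLift (a t) :=
    velocityLift_eq (ha.hasMFDerivAt_proj ht)
  exact ⟨fun t ↦ (a t).proj,
    ⟨⟨ε, hε, ha.isGeodesicOn isOpen_Ioo⟩, hvel 0 ⟨by linarith, by linarith⟩⟩,
    hvel 1 ⟨by linarith, by linarith⟩⟩

end HamiltonianMotion

/-! ### Degeneracy -/

section GraphsOfDifferentials

theorem symm_mem_of_mem_image_inter_source {X Y : Type*} [TopologicalSpace X] [TopologicalSpace Y]
    {Ψ : OpenPartialHomeomorph X Y} {S : Set X} {y : Y} (hy : y ∈ Ψ '' (S ∩ Ψ.source)) :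
    Ψ.symm y ∈ S := by
  obtain ⟨x, ⟨hxS, hx⟩, rfl⟩ := hy
  rwa [Ψ.left_inv hx]

variable {V : Type*} [NormedAddCommGroup V] [NormedSpace ℝ V] {f h : V → ℝ} {w₀ : V}

theorem hasFDerivAt_graph_fderiv (hf : ContDiffAt ℝ 2 f w₀) :
    HasFDerivAt (fun w ↦ (w, fderiv ℝ f w))
      ((ContinuousLinearMap.id ℝ V).prod (fderiv ℝ (fderiv ℝ f) w₀)) w₀ :=
  (hasFDerivAt_id w₀).prodMk
    ((hf.fderiv_right (m := 1) (by norm_num)).differentiableAt one_ne_zero).hasFDerivAt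

theorem fderiv_fderiv_sub_eq (hf : ContDiffAt ℝ 2 f w₀) (hh : ContDiffAt ℝ 2 h w₀) :
    fderiv ℝ (fderiv ℝ fun w ↦ f w - h w) w₀ =
      fderiv ℝ (fderiv ℝ f) w₀ - fderiv ℝ (fderiv ℝ h) w₀ := by
  have hsub : fderiv ℝ (fun w ↦ f w - h w) =ᶠ[𝓝 w₀] fun w ↦ fderiv ℝ f w - fderiv ℝ h w := by
    filter_upwards [hf.eventually (by simp), hh.eventually (by simp)] with w hfw hhw
    exact fderiv_fun_sub (hfw.differentiableAt two_ne_zero) (hhw.differentiableAt two_ne_zero)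
  rw [hsub.fderiv_eq]
  exact fderiv_fun_sub ((hf.fderiv_right (m := 1) (by norm_num)).differentiableAt one_ne_zero)
    ((hh.fderiv_right (m := 1) (by norm_num)).differentiableAt one_ne_zero)

end GraphsOfDifferentials

section Degeneracy

variable [IsManifold 𝓘(ℝ, E) ∞ M]

theorem apply_fst_eq_zero_of_eventually_proj_eq {W : Type*} [NormedAddCommGroup W]
    [NormedSpace ℝ W] {σ : W → CotangentBundle E M} {w₀ : W} {B : W →L[ℝ] E × (E →L[ℝ] ℝ)}
    (hσ : HasMFDerivAt 𝓘(ℝ, W) (cotangentModel E) σ w₀ B) {x : M}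
    (hx : ∀ᶠ w in 𝓝 w₀, (σ w).proj = x) (u : W) : (B u).1 = 0 := by
  have hproj := (hasMFDerivAt_totalSpace_proj (F := E →L[ℝ] ℝ) _ (σ w₀)).comp w₀ hσ
  have hconst := (hasMFDerivAt_const (I := 𝓘(ℝ, W)) (I' := 𝓘(ℝ, E)) x w₀).congr_of_eventuallyEq hx
  exact congrArg (fun A : W →L[ℝ] E ↦ A u) (hasMFDerivAt_unique hproj hconst)

variable [FiniteDimensional ℝ E] [RiemannianBundle (fun x : M ↦ TangentSpace 𝓘(ℝ, E) x)]
  {α : CotangentBundle E M} {p : CotangentBundle E M × CotangentBundle E M}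

variable [IsContMDiffRiemannianBundle 𝓘(ℝ, E) ∞ E (fun x : M ↦ TangentSpace 𝓘(ℝ, E) x)]

theorem sharpVec_mem_expDomain (hp : p ∈ flowGraph E M) :
    sharpVec (E := E) p.1 ∈ expDomain p.1.proj :=
  (exists_isGeodesicFrom_of_mem_flowGraph hp).imp fun _ h ↦ h.1

theorem expMap_sharpVec [T2Space M] (hp : p ∈ flowGraph E M) :
    expMap p.1.proj (sharpVec (E := E) p.1) = p.2.proj := by
  obtain ⟨γ, hγ, hγ1⟩ := exists_isGeodesicFrom_of_mem_flowGraph hp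
  exact (expMap_eq hγ).trans (congrArg TotalSpace.proj hγ1)

theorem IsGeodesicFlowAt.eventually_sharpLift
    {Φ : TangentBundle 𝓘(ℝ, E) M → TangentBundle 𝓘(ℝ, E) M}
    (hΦ : IsGeodesicFlowAt Φ (sharpLift α)) :
    ∀ᶠ β in 𝓝 α, ∀ β', (β, β') ∈ flowGraph E M → Φ (sharpLift β) = sharpLift β' := by
  obtain ⟨S, hS, -⟩ := exists_hasMFDerivAt_sharpLift α
  filter_upwards [hS.continuousAt.eventually hΦ] with β hβ β' hp
  obtain ⟨γ, hγ, hγ1⟩ := exists_isGeodesicFrom_of_mem_flowGraph hp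
  exact (hβ.2 γ hγ).symm.trans hγ1

variable [T2Space M]
  {W : Type*} [NormedAddCommGroup W] [NormedSpace ℝ W] {w₀ : W} {K : Submodule ℝ W}

theorem finrank_le_conjMultiplicity_of_hasMFDerivAt {σ₁ σ₂ : W → CotangentBundle E M}
    {B₁ B₂ : W →L[ℝ] E × (E →L[ℝ] ℝ)}
    (h₁ : HasMFDerivAt 𝓘(ℝ, W) (cotangentModel E) σ₁ w₀ B₁)
    (h₂ : HasMFDerivAt 𝓘(ℝ, W) (cotangentModel E) σ₂ w₀ B₂)
    (hσ : ∀ᶠ w in 𝓝 w₀, (σ₁ w, σ₂ w) ∈ flowGraph E M)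
    (hK : ∀ u ∈ K, (B₁ u).1 = 0 ∧ (B₂ u).1 = 0) (hinj : ∀ u ∈ K, B₁ u = 0 → B₂ u = 0 → u = 0) :
    finrank ℝ K ≤ conjMultiplicity (σ₁ w₀).proj (sharpVec (E := E) (σ₁ w₀)) := by
  obtain ⟨Φ, hΦ, hdiff⟩ := exists_isGeodesicFlowAt (sharpVec_mem_expDomain hσ.self_of_nhds)
  have hΦ : IsGeodesicFlowAt Φ (sharpLift (σ₁ w₀)) := hΦ
  obtain ⟨L, hL⟩ : ∃ L : E × E →L[ℝ] E × E,
      HasMFDerivAt 𝓘(ℝ, E).tangent 𝓘(ℝ, E).tangent Φ (sharpLift (σ₁ w₀)) L :=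
    ⟨_, hdiff.hasMFDerivAt⟩
  obtain ⟨S, hS, hS_fst, hS_inj⟩ := exists_hasMFDerivAt_sharpLift (σ₁ w₀)
  obtain ⟨R, hR, hR_fst, hR_inj⟩ := exists_hasMFDerivAt_sharpLift (σ₂ w₀)
  have hflow : (fun w ↦ sharpLift (σ₂ w)) =ᶠ[𝓝 w₀] fun w ↦ Φ (sharpLift (σ₁ w)) := by
    filter_upwards [hσ, h₁.continuousAt.eventually hΦ.eventually_sharpLift] with w hw hΦw
      using (hΦw _ hw).symm
  have hLS : L ∘L S ∘L B₁ = R ∘L B₂ := hasMFDerivAt_unique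
    ((hL.comp w₀ (hS.comp w₀ h₁)).congr_of_eventuallyEq hflow) (hR.comp w₀ h₂)
  have hLS (u : W) : L (S (B₁ u)) = R (B₂ u) := congrArg (fun A : W →L[ℝ] E × E ↦ A u) hLS
  let T : K →ₗ[ℝ] E := (ContinuousLinearMap.snd ℝ E E ∘L S ∘L B₁).toLinearMap ∘ₗ K.subtype
  have hT (u : K) : S (B₁ u) = (0, T u) := Prod.ext ((hS_fst _).trans (hK u u.2).1) rfl
  have hT_mem (u : K) : T u ∈ expKer (σ₁ w₀).proj (sharpVec (E := E) (σ₁ w₀)) := by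
    have hd := (hΦ.hasMFDerivAt_expMap hL).mfderiv
    have hLT : (L (0, T u)).1 = 0 := by rw [← hT, hLS, hR_fst, (hK u u.2).2]
    exact (congrArg (fun A : E →L[ℝ] E ↦ A (T u)) hd).trans hLT
  have : FiniteDimensional ℝ (TangentSpace 𝓘(ℝ, E) (σ₁ w₀).proj) :=
    inferInstanceAs (FiniteDimensional ℝ E)
  refine LinearMap.finrank_le_finrank_of_injective (f := T.codRestrict (expKer _ _) hT_mem)
    ((injective_iff_map_eq_zero _).2 fun u hu ↦ Subtype.ext ?_)
  have hSu : S (B₁ u) = 0 := by rw [hT, show T u = 0 from congrArg Subtype.val hu]; rfl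
  have hRu : R (B₂ u) = 0 := by rw [← hLS, hSu, map_zero]
  exact hinj u u.2 ((map_eq_zero_iff S hS_inj).1 hSu) ((map_eq_zero_iff R hR_inj).1 hRu)

theorem finrank_le_conjMultiplicity_of_tangent {V : Type*} [NormedAddCommGroup V] [NormedSpace ℝ V]
    {Ψ : OpenPartialHomeomorph (CotangentBundle E M × CotangentBundle E M) V}
    (hΨ : Ψ.MDifferentiable ((cotangentModel E).prod (cotangentModel E)) 𝓘(ℝ, V))
    (hp : p ∈ Ψ.source)
    {F H : W → V} {F' H' : W →L[ℝ] V} (hF : HasFDerivAt F F' w₀) (hH : HasFDerivAt H H' w₀)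
    (hF₀ : F w₀ = Ψ p) (hH₀ : H w₀ = Ψ p) {x X : M}
    (hΓ : ∀ᶠ w in 𝓝 w₀, Ψ.symm (F w) ∈ flowGraph E M)
    (hB : ∀ᶠ w in 𝓝 w₀, Ψ.symm (H w) ∈ boundarySet E x X)
    (hinj : Function.Injective F') (hK : ∀ u ∈ K, F' u = H' u) :
    finrank ℝ K ≤ conjMultiplicity p.1.proj (sharpVec (E := E) p.1) := by
  obtain ⟨A, hA, hA_inj⟩ : ∃ A : V →L[ℝ] (E × (E →L[ℝ] ℝ)) × (E × (E →L[ℝ] ℝ)),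
      HasMFDerivAt 𝓘(ℝ, V) ((cotangentModel E).prod (cotangentModel E)) Ψ.symm (Ψ p) A ∧
        Function.Injective A :=
    ⟨_, (hΨ.symm.mdifferentiableAt (Ψ.map_source hp)).hasMFDerivAt,
      hΨ.symm.mfderiv_injective (Ψ.map_source hp)⟩
  have hends {G : W → V} {G' : W →L[ℝ] V} (hG : HasFDerivAt G G' w₀) (hG₀ : G w₀ = Ψ p) :
      HasMFDerivAt 𝓘(ℝ, W) (cotangentModel E) (fun w ↦ (Ψ.symm (G w)).1) w₀
        (ContinuousLinearMap.fst ℝ (E × (E →L[ℝ] ℝ)) (E × (E →L[ℝ] ℝ)) ∘L A ∘L G') ∧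
      HasMFDerivAt 𝓘(ℝ, W) (cotangentModel E) (fun w ↦ (Ψ.symm (G w)).2) w₀
        (ContinuousLinearMap.snd ℝ (E × (E →L[ℝ] ℝ)) (E × (E →L[ℝ] ℝ)) ∘L A ∘L G') := by
    have hcomp := (hG₀ ▸ hA).comp w₀ hG.hasMFDerivAt
    exact ⟨(hasMFDerivAt_fst _).comp w₀ hcomp, (hasMFDerivAt_snd _).comp w₀ hcomp⟩
  obtain ⟨hF₁, hF₂⟩ := hends hF hF₀
  obtain ⟨hH₁, hH₂⟩ := hends hH hH₀
  have hle := finrank_le_conjMultiplicity_of_hasMFDerivAt (K := K) hF₁ hF₂ hΓ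
    (fun u hu ↦ ?_) (fun u _ h₁ h₂ ↦ ?_)
  · rwa [hF₀, Ψ.left_inv hp] at hle
  · have hAu : A (F' u) = A (H' u) := congrArg A (hK u hu)
    have hAu₁ : (A (H' u)).1.1 = 0 :=
      apply_fst_eq_zero_of_eventually_proj_eq hH₁ (hB.mono fun w hw ↦ hw.1) u
    have hAu₂ : (A (H' u)).2.1 = 0 :=
      apply_fst_eq_zero_of_eventually_proj_eq hH₂ (hB.mono fun w hw ↦ hw.2) u
    exact ⟨(congrArg (·.1.1) hAu).trans hAu₁, (congrArg (·.2.1) hAu).trans hAu₂⟩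
  · exact (map_eq_zero_iff F' hinj).1 ((map_eq_zero_iff A hA_inj).1 (Prod.ext h₁ h₂))

theorem HasDegeneracy.le_conjMultiplicity {x X : M} {m : ℕ}
    (h : HasDegeneracy (flowGraph E M) (boundarySet E x X) p m)
    (hp : p ∈ flowGraph E M ∩ boundarySet E x X) :
    m ≤ conjMultiplicity p.1.proj (sharpVec (E := E) p.1) := by
  obtain ⟨Ψ, D, f, h, ⟨hΨ, hΨ', -⟩, hpΨ, hD, hf, hh, hΓ, hB, rfl⟩ := h
  obtain ⟨w₀, hw₀, hf₀⟩ : Ψ p ∈ (fun w ↦ (w, fderiv ℝ f w)) '' D :=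
    hΓ ▸ mem_image_of_mem Ψ ⟨hp.1, hpΨ⟩
  obtain ⟨w₁, -, hh₀⟩ : Ψ p ∈ (fun w ↦ (w, fderiv ℝ h w)) '' D :=
    hB ▸ mem_image_of_mem Ψ ⟨hp.2, hpΨ⟩
  obtain rfl : w₁ = w₀ := (congrArg Prod.fst hh₀).trans (congrArg Prod.fst hf₀).symm
  obtain rfl : w₁ = (Ψ p).1 := congrArg Prod.fst hf₀
  have hDw := hD.mem_nhds hw₀
  have hf' := (hf.contDiffAt hDw).of_le (m := 2) (WithTop.coe_le_coe.2 le_top)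
  have hh' := (hh.contDiffAt hDw).of_le (m := 2) (WithTop.coe_le_coe.2 le_top)
  have hΨ_diff : Ψ.MDifferentiable _ _ :=
    ⟨hΨ.mdifferentiableOn (by simp), hΨ'.mdifferentiableOn (by simp)⟩
  refine finrank_le_conjMultiplicity_of_tangent (x := x) (X := X) hΨ_diff hpΨ
    (hasFDerivAt_graph_fderiv hf') (hasFDerivAt_graph_fderiv hh') hf₀ hh₀ ?_ ?_
    (fun u u' huu' ↦ congrArg Prod.fst huu') fun u hu ↦ Prod.ext rfl ?_
  · filter_upwards [hDw] with w hw
      using symm_mem_of_mem_image_inter_source (hΓ ▸ mem_image_of_mem _ hw)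
  · filter_upwards [hDw] with w hw
      using symm_mem_of_mem_image_inter_source (hB ▸ mem_image_of_mem _ hw)
  · refine sub_eq_zero.1 (Eq.trans ?_ hu)
    rw [fderiv_fderiv_sub_eq hf' hh']
    rfl

end Degeneracy

end ConjugatePoints

end

open ConjugatePoints in
theorem mainTheorem6_general
    {E : Type*} [NormedAddCommGroup E] [NormedSpace ℝ E] [FiniteDimensional ℝ E] [Nontrivial E]
    {M : Type*} [TopologicalSpace M] [T2Space M] [ChartedSpace E M] [IsManifold 𝓘(ℝ, E) ∞ M]
    [RiemannianBundle (fun x : M ↦ TangentSpace 𝓘(ℝ, E) x)]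
    [IsContMDiffRiemannianBundle 𝓘(ℝ, E) ∞ E (fun x : M ↦ TangentSpace 𝓘(ℝ, E) x)] :
    (∀ (x : M), ∀ v ∈ expDomain (E := E) x, conjMultiplicity x v < finrank ℝ E) ∧
    (∀ x X : M, ∀ p ∈ flowGraph E M ∩ boundarySet E x X, ∀ m : ℕ,
      HasDegeneracy (flowGraph E M) (boundarySet E x X) p m →
        ∃ v ∈ expDomain x, expMap (E := E) x v = X ∧ m ≤ conjMultiplicity x v) := by
  refine ⟨fun x v hv ↦ finrank_expKer_lt hv, fun x X p hp m hm ↦ ?_⟩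
  obtain ⟨hpΓ, rfl, rfl⟩ := hp
  exact ⟨sharpVec (E := E) p.1, sharpVec_mem_expDomain (E := E) hpΓ, expMap_sharpVec (E := E) hpΓ,
    hm.le_conjMultiplicity ⟨hpΓ, rfl, rfl⟩⟩

open ConjugatePoints in
theorem mainTheorem6
    {E : Type*} [NormedAddCommGroup E] [NormedSpace ℝ E] [FiniteDimensional ℝ E]
    {M : Type*} [TopologicalSpace M] [T2Space M] [ChartedSpace E M] [IsManifold 𝓘(ℝ, E) ∞ M]
    [RiemannianBundle (fun x : M ↦ TangentSpace 𝓘(ℝ, E) x)]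
    [IsContMDiffRiemannianBundle 𝓘(ℝ, E) ∞ E (fun x : M ↦ TangentSpace 𝓘(ℝ, E) x)]
    (n : ℕ) (hn : finrank ℝ E = n) :
    (∀ (x : M) (v : TangentSpace 𝓘(ℝ, E) x), IsConjugateAlong x v →
      conjMultiplicity x v < n) ∧
    (∀ x X : M, X ∈ conjugateLocus E x →
      ∀ p ∈ flowGraph E M ∩ boundarySet E x X, ∀ m : ℕ,
        HasDegeneracy (flowGraph E M) (boundarySet E x X) p m → m < n) := by
  subst hn
  refine ⟨fun x v hv ↦ ?_, fun x X ⟨v, hv, _⟩ p hp m hm ↦ ?_⟩ <;> have := hv.nontrivial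
  · exact mainTheorem6_general.1 x v hv.1
  · obtain ⟨w, hw, -, hmw⟩ := mainTheorem6_general.2 x X p hp m hm
    exact hmw.trans_lt (mainTheorem6_general.1 x w hw)
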